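/- Let $S$ be a countable left cancellative monoid with identity $e$. Let $I_\ell(S)$ be its left inverse hull, i.e. the inverse semigroup of partial bijections of $S$ generated by the left translations $t\mapsto st$ ($s\in S$); we identify $s\in S$ with the corresponding left translation, write $s^{-1}$ for the inverse partial bijection $sS\to S$, and write $0$ for the map with empty domain (if it belongs to $I_\ell(S)$). Every element of $I_\ell(S)$ has the form $s_1^{-1}t_1\cdots s_n^{-1}t_n$ with $s_i,t_i\in S$. Let $\mathcal J(S)$ be the set of constructible right ideals $X=s_1^{-1}t_1\cdots s_n^{-1}t_nS$ of $S$, and for $X\in\mathcal J(S)$ let $p_X\in I_\ell(S)$ be the identity map of $X$; the $p_X$ are exactly the elements of the semigroup $E(S)$ of idempotents of $I_\ell(S)$. Let $\widehat{E(S)}$ be the space of nonzero multiplicative maps $\chi\colon E(S)\to\{0,1\}$ with the topology of pointwise convergence, let $\chi_s(p_X)=\mathbf 1_X(s)$ for $s\in S$, and let $\Omega(S)=\overline{\{\chi_s: s\in S\}}\subset\widehat{E(S)}$. Let $\mathcal G(I_\ell(S))$ be the Paterson groupoid: the set of classes $[g,\chi]$ of pairs $(g,\chi)\in I_\ell(S)\times\widehat{E(S)}$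 with $\chi(g^{-1}g)=1$, where $[g_1,\chi_1]=[g_2,\chi_2]$ iff $\chi_1=\chi_2$ and $g_1p=g_2p$ for some $p\in E(S)$ with $\chi_1(p)=1$; its operations are $[g,\chi][h,\psi]=[gh,\psi]$ if $\chi=\psi(h^{-1}\cdot h)$, and $[g,\chi]^{-1}=[g^{-1},\chi(g^{-1}\cdot g)]$; its source and range maps are $[g,\chi]\mapsto\chi$ and $[g,\chi]\mapsto\chi(g^{-1}\cdot g)$; and its topology has as a basis the sets $D(g,U)=\{[g,\chi]:\chi\in U\}$, with $U$ open in $\{\chi:\chi(g^{-1}g)=1\}$. Let $\mathcal G_P(S)$ be its reduction to the closed invariant set $\Omega(S)$, and let $D(g,\Omega(S))\subset\mathcal G_P(S)$ be the set of all classes $[g,\chi]$ with $\chi\in\Omega(S)$ and $\chi(g^{-1}g)=1$. Let $C^*(\mathcal G_P(S))$ be its full C$^*$-algebra, i.e. the C$^*$-enveloping algebra of the convolution $*$-algebra $C_c(\mathcal G_P(S))$, which is the linear span of the functions that are continuous with compact support on some open Hausdorff subset and zero outside it. Put $v_s=\mathbf 1_{D(s,\Omega(S))}\in C^*(\mathcal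 G_P(S))$ for $s\in S$. Then $C^*(\mathcal G_P(S))$ is the universal unital C$^*$-algebra generated by the elements $v_s$, $s\in S$, subject to the relations (R1) $v_e=1$; (R2) for every $g=s_1^{-1}t_1\cdots s_n^{-1}t_n\in I_\ell(S)$, the element $v_g:=v_{s_1}^*v_{t_1}\cdots v_{s_n}^*v_{t_n}$ is independent of the presentation of $g$; (R3) if $0\in I_\ell(S)$, then $v_0=0$; (R4) if $X=X_1\cup\dots\cup X_n$ for some $n\ge1$ and $X,X_1,\dots,X_n\in\mathcal J(S)$, then $\prod_{i=1}^n(v_{p_X}-v_{p_{X_i}})=0$. That is: the elements $v_s$ satisfy (R1)–(R4); they generate $C^*(\mathcal G_P(S))$ as a C$^*$-algebra; and for every unital C$^*$-algebra $B$ and all elements $b_s\in B$, $s\in S$, satisfying (R1)–(R4), there is a unique unital $*$-homomorphism $\varphi\colon C^*(\mathcal G_P(S))\to B$ with $\varphi(v_s)=b_s$ for all $s\in S$. -/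

import Mathlib

/-! ### C*-seminorms and the C*-enveloping algebra of a unital *-algebra -/

section Envelope

universe u

/-- A C*-seminorm on a unital complex *-algebra. -/
structure CStarSeminorm (A : Type u) [Ring A] [StarRing A] [Algebra ℂ A] extends
    Seminorm ℂ A where
  mul_le' : ∀ a b : A, toFun (a * b) ≤ toFun a * toFun b
  star_mul_self' : ∀ a : A, toFun (star a * a) = toFun a * toFun a

namespace CStarSeminorm

variable {A : Type u} [Ring A] [StarRing A] [Algebra ℂ A]

noncomputable instance : CoeFun (CStarSeminorm A) (fun _ => A → ℝ) := ⟨fun p => p.toSeminorm⟩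

theorem mul_le (p : CStarSeminorm A) (a b : A) : p (a * b) ≤ p a * p b := p.mul_le' a b

theorem star_mul_self (p : CStarSeminorm A) (a : A) : p (star a * a) = p a * p a :=
  p.star_mul_self' a

theorem nonneg (p : CStarSeminorm A) (a : A) : 0 ≤ p a := apply_nonneg p.toSeminorm a

theorem le_star (p : CStarSeminorm A) (a : A) : p a ≤ p (star a) := by
  rcases (p.nonneg a).eq_or_lt with h | h
  · rw [← h]; exact p.nonneg _
  · have := p.mul_le (star a) a
    rw [p.star_mul_self] at this
    exact le_of_mul_le_mul_right this h

theorem star_eq (p : CStarSeminorm A) (a : A) : p (star a) = p a :=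
  le_antisymm (by simpa using p.le_star (star a)) (p.le_star a)

/-- The algebra `A` carrying the topology of the C*-seminorm `p`. -/
def Carrier (_ : CStarSeminorm A) : Type u := A

variable (p : CStarSeminorm A)

instance : Ring p.Carrier := inferInstanceAs (Ring A)
instance : StarRing p.Carrier := inferInstanceAs (StarRing A)
instance : Algebra ℂ p.Carrier := inferInstanceAs (Algebra ℂ A)

noncomputable instance : SeminormedRing p.Carrier :=
  { (inferInstance : Ring p.Carrier),
    (AddGroupSeminorm.toSeminormedAddCommGroup
      (show AddGroupSeminorm p.Carrier from p.toSeminorm.toAddGroupSeminorm)) with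
    norm_mul_le := p.mul_le }

theorem norm_carrier (a : p.Carrier) : ‖a‖ = p (show A from a) := rfl

noncomputable instance : NormedSpace ℂ p.Carrier where
  norm_smul_le c a := (map_smul_eq_mul p.toSeminorm c (show A from a)).le

theorem norm_star_carrier (a : p.Carrier) : ‖star a‖ = ‖a‖ := p.star_eq a

theorem isometry_star : Isometry (star : p.Carrier → p.Carrier) :=
  AddMonoidHomClass.isometry_of_norm (starAddEquiv : p.Carrier ≃+ p.Carrier) p.norm_star_carrier

/-- The Hausdorff completion of `A` with respect to the C*-seminorm `p`. -/
def Completion : Type u := UniformSpace.Completion p.Carrier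

noncomputable instance : NormedRing p.Completion :=
  inferInstanceAs (NormedRing (UniformSpace.Completion p.Carrier))

instance : CompleteSpace p.Completion :=
  inferInstanceAs (CompleteSpace (UniformSpace.Completion p.Carrier))

noncomputable instance : Algebra ℂ p.Completion :=
  inferInstanceAs (Algebra ℂ (UniformSpace.Completion p.Carrier))

/-- The canonical map into the completion. -/
noncomputable def coe (a : A) : p.Completion :=
  ((show p.Carrier from a : p.Carrier) : UniformSpace.Completion p.Carrier)

theorem norm_coe (a : A) : ‖p.coe a‖ = p a := 
  UniformSpace.Completion.norm_coe (E := p.Carrier) a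

theorem continuous_coe : Continuous (fun a : p.Carrier => p.coe a) :=
  UniformSpace.Completion.continuous_coe p.Carrier

theorem denseRange_coe : DenseRange (fun a : p.Carrier => p.coe a) :=
  UniformSpace.Completion.denseRange_coe (α := p.Carrier)

theorem induction {P : p.Completion → Prop} (x : p.Completion) (hc : IsClosed {x | P x})
    (h : ∀ a : A, P (p.coe a)) : P x :=
  UniformSpace.Completion.induction_on (α := p.Carrier) x hc h

theorem coe_add (a b : A) : p.coe (a + b) = p.coe a + p.coe b :=
  UniformSpace.Completion.coe_add (α := p.Carrier) a b

theorem coe_mul (a b : A) : p.coe (a * b) = p.coe a * p.coe b :=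
  UniformSpace.Completion.coe_mul (α := p.Carrier) a b

theorem coe_one : p.coe 1 = 1 := UniformSpace.Completion.coe_one p.Carrier

theorem coe_zero : p.coe 0 = 0 := UniformSpace.Completion.coe_zero (α := p.Carrier)

theorem coe_smul (c : ℂ) (a : A) : p.coe (c • a) = c • p.coe a :=
  UniformSpace.Completion.coe_smul (X := p.Carrier) c a

noncomputable instance : NormedAlgebra ℂ p.Completion where
  norm_smul_le c x := by
    refine norm_smul_le (α := ℂ) (β := UniformSpace.Completion p.Carrier) c x

noncomputable instance : Star p.Completion where
  star := UniformSpace.Completion.map (star : p.Carrier → p.Carrier)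

theorem coe_star (a : A) : p.coe (star a) = star (p.coe a) :=
  (UniformSpace.Completion.map_coe p.isometry_star.uniformContinuous (show p.Carrier from a)).symm

theorem continuous_star : Continuous (star : p.Completion → p.Completion) :=
  UniformSpace.Completion.continuous_map

noncomputable instance : StarRing p.Completion where
  star_involutive x := by
    refine p.induction (P := fun x => star (star x) = x) x
      (isClosed_eq (p.continuous_star.comp p.continuous_star) continuous_id) fun a => ?_
    rw [← coe_star, ← coe_star, star_star]
  star_mul x y := by
    refine p.induction (P := fun x => star (x * y) = star y * star x) x
      (isClosed_eq (p.continuous_star.comp (continuous_mul_const y))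
        (p.continuous_star.const_mul _)) fun a => ?_
    refine p.induction (P := fun y => star (p.coe a * y) = star y * star (p.coe a)) y
      (isClosed_eq (p.continuous_star.comp (continuous_const_mul _))
        (p.continuous_star.mul_const _)) fun b => ?_
    rw [← coe_mul, ← coe_star, ← coe_star, ← coe_star, ← coe_mul, star_mul]
  star_add x y := by
    refine p.induction (P := fun x => star (x + y) = star x + star y) x
      (isClosed_eq (p.continuous_star.comp (continuous_add_const y))
        (p.continuous_star.add continuous_const)) fun a => ?_
    refine p.induction (P := fun y => star (p.coe a + y) = star (p.coe a) + star y) y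
      (isClosed_eq (p.continuous_star.comp (continuous_const_add _))
        (continuous_const.add p.continuous_star)) fun b => ?_
    rw [← coe_add, ← coe_star, ← coe_star, ← coe_star, ← coe_add, star_add]

noncomputable instance [StarModule ℂ A] : CStarAlgebra p.Completion where
  norm_mul_self_le x := by
    refine p.induction (P := fun x => ‖x‖ * ‖x‖ ≤ ‖star x * x‖) x
      (isClosed_le (continuous_norm.mul continuous_norm)
        (continuous_norm.comp (p.continuous_star.mul continuous_id))) fun a => ?_
    rw [← coe_star, ← coe_mul, norm_coe, norm_coe, star_mul_self]
  star_smul c x := by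
    refine p.induction (P := fun x => star (c • x) = star c • star x) x
      (isClosed_eq (p.continuous_star.comp (continuous_const_smul c))
        ((continuous_const_smul (star c)).comp p.continuous_star)) fun a => ?_
    rw [← coe_smul, ← coe_star, ← coe_star, ← coe_smul, star_smul]

/-- The canonical unital *-homomorphism into the completion. -/
noncomputable def toCompletion [StarModule ℂ A] : A →⋆ₐ[ℂ] p.Completion where
  toFun := p.coe
  map_one' := p.coe_one
  map_mul' := p.coe_mul
  map_zero' := p.coe_zero
  map_add' := p.coe_add
  commutes' c := by
    rw [Algebra.algebraMap_eq_smul_one, Algebra.algebraMap_eq_smul_one, coe_smul, coe_one]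
  map_star' := p.coe_star

/-- Every C*-seminorm on a C*-algebra is dominated by the norm. -/
theorem le_norm {D : Type u} [CStarAlgebra D] (q : CStarSeminorm D) (a : D) : q a ≤ ‖a‖ := by
  rw [← q.norm_coe]
  exact NonUnitalStarAlgHom.norm_apply_le q.toCompletion a

/-- The zero C*-seminorm. -/
noncomputable instance : Inhabited (CStarSeminorm A) :=
  ⟨{ (0 : Seminorm ℂ A) with
      mul_le' := fun _ _ => (mul_zero (0 : ℝ)).ge
      star_mul_self' := fun _ => (mul_zero (0 : ℝ)).symm }⟩

end CStarSeminorm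

/-- Every element of the *-algebra `A` is uniformly bounded over all C*-seminorms on `A`
(equivalently, over all *-representations by bounded operators on Hilbert spaces). -/
class HasCStarEnvelope (A : Type u) [Ring A] [StarRing A] [Algebra ℂ A] : Prop where
  bddAbove : ∀ a : A, BddAbove (Set.range fun p : CStarSeminorm A => p a)

section

variable (A : Type u) [Ring A] [StarRing A] [Algebra ℂ A] [HasCStarEnvelope A]

variable {A} in
theorem CStarSeminorm.le_iSup (p : CStarSeminorm A) (a : A) :
    p a ≤ ⨆ q : CStarSeminorm A, q a :=
  le_ciSup (HasCStarEnvelope.bddAbove a) p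

/-- The largest C*-seminorm on `A`. -/
noncomputable def maxCStarSeminorm : CStarSeminorm A where
  toFun a := ⨆ p : CStarSeminorm A, p a
  map_zero' := by simp
  add_le' a b := ciSup_le fun p =>
    (map_add_le_add p.toSeminorm a b).trans (add_le_add (p.le_iSup a) (p.le_iSup b))
  neg' a := by simp
  smul' c a := by
    simp only [map_smul_eq_mul]
    exact (Real.mul_iSup_of_nonneg (norm_nonneg c) _).symm
  mul_le' a b := ciSup_le fun p =>
    (p.mul_le a b).trans (mul_le_mul (p.le_iSup a) (p.le_iSup b) (p.nonneg b)
      ((p.nonneg a).trans (p.le_iSup a)))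
  star_mul_self' a := by
    have h0 : 0 ≤ ⨆ p : CStarSeminorm A, p a := Real.iSup_nonneg fun p => p.nonneg a
    apply le_antisymm
    · refine ciSup_le fun p => ?_
      rw [p.star_mul_self]
      exact mul_le_mul (p.le_iSup a) (p.le_iSup a) (p.nonneg a) h0
    · rw [← Real.sqrt_le_sqrt_iff (Real.iSup_nonneg fun p => p.nonneg _), Real.sqrt_mul_self h0]
      refine ciSup_le fun p => Real.le_sqrt_of_sq_le ?_
      rw [sq, ← p.star_mul_self]
      exact p.le_iSup _

/-- The C*-enveloping algebra of `A`: the Hausdorff completion in the largest C*-seminorm. -/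
abbrev CStarEnvelope : Type u := (maxCStarSeminorm A).Completion

/-- The canonical unital *-homomorphism of `A` into its C*-enveloping algebra. -/
noncomputable abbrev CStarEnvelope.of [StarModule ℂ A] : A →⋆ₐ[ℂ] CStarEnvelope A :=
  (maxCStarSeminorm A).toCompletion

end

end Envelope

/-! ### The left inverse hull and its semi-characters -/

section Hull

universe u

variable {S : Type u} [LeftCancelMonoid S]

open Classical in
/-- The left translation `t ↦ s * t`, as a partial bijection of `S` with domain `S` and
image `sS`. -/
noncomputable def leftTranslation (s : S) : S ≃. S where
  toFun t := some (s * t)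
  invFun x := if h : ∃ t, s * t = x then some h.choose else none
  inv t x := by
    by_cases h : ∃ t, s * t = x
    · simp only [h, dite_true, Option.some.injEq]
      constructor
      · intro ht; rw [← ht]; exact h.choose_spec
      · intro ht; exact mul_left_cancel (h.choose_spec.trans ht.symm)
    · simp only [h, dite_false, Option.some.injEq]
      constructor
      · intro ht; cases ht
      · intro ht; exact absurd ⟨t, ht⟩ h

theorem mem_leftTranslation {s t x : S} : x ∈ leftTranslation s t ↔ s * t = x := by
  simp [leftTranslation]

/-- Membership in the inverse semigroup of partial bijections generated by the left
translations. -/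
inductive InLeftHull : (S ≃. S) → Prop
  | translation (s : S) : InLeftHull (leftTranslation s)
  | symm {f : S ≃. S} : InLeftHull f → InLeftHull f.symm
  | trans {f g : S ≃. S} : InLeftHull f → InLeftHull g → InLeftHull (f.trans g)

variable (S) in
/-- The left inverse hull of `S`. -/
def LeftHull : Type u := {f : S ≃. S // InLeftHull f}

namespace LeftHull

theorem refl_mem : InLeftHull (PEquiv.refl S) := by
  have : leftTranslation (1 : S) = PEquiv.refl S := by
    ext t x
    simp [leftTranslation]
  exact this ▸ InLeftHull.translation 1

/-- The product `g * h` is the composition of partial maps `g ∘ h`. -/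
noncomputable instance : Monoid (LeftHull S) where
  mul g h := ⟨h.1.trans g.1, h.2.trans g.2⟩
  one := ⟨PEquiv.refl S, refl_mem⟩
  mul_assoc f g h := Subtype.ext (PEquiv.trans_assoc h.1 g.1 f.1).symm
  one_mul f := Subtype.ext (PEquiv.trans_refl f.1)
  mul_one f := Subtype.ext (PEquiv.refl_trans f.1)

noncomputable instance : Inv (LeftHull S) where
  inv g := ⟨g.1.symm, g.2.symm⟩

/-- The left translation by `s` as an element of the left inverse hull. -/
noncomputable def tr (s : S) : LeftHull S := ⟨leftTranslation s, .translation s⟩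

@[ext] theorem ext {g h : LeftHull S} (H : ∀ x y, y ∈ g.1 x ↔ y ∈ h.1 x) : g = h :=
  Subtype.ext (PEquiv.ext fun x => Option.ext fun y => H x y)

theorem mem_mul {g h : LeftHull S} {x y : S} :
    y ∈ (g * h).1 x ↔ ∃ z, z ∈ h.1 x ∧ y ∈ g.1 z := PEquiv.mem_trans h.1 g.1 x y

theorem mem_one {x y : S} : y ∈ (1 : LeftHull S).1 x ↔ x = y := by
  change some x = some y ↔ _
  simp

theorem mem_inv {g : LeftHull S} {x y : S} : y ∈ (g⁻¹).1 x ↔ x ∈ g.1 y := PEquiv.mem_iff_mem g.1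

theorem val_inj {g : LeftHull S} {x y z : S} (h : z ∈ g.1 x) (h' : z ∈ g.1 y) : x = y :=
  PEquiv.inj g.1 h h'

theorem val_unique {g : LeftHull S} {x y z : S} (h : y ∈ g.1 x) (h' : z ∈ g.1 x) : y = z :=
  Option.mem_unique h h'

theorem inv_inv' (g : LeftHull S) : g⁻¹⁻¹ = g := rfl

theorem mul_inv' (g h : LeftHull S) : (g * h)⁻¹ = h⁻¹ * g⁻¹ := rfl

theorem isIdempotentElem_iff {p : LeftHull S} :
    IsIdempotentElem p ↔ ∀ x y, y ∈ p.1 x → x = y := by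
  constructor
  · intro hp x y hxy
    have h2 : y ∈ (p * p).1 x := by rw [hp.eq]; exact hxy
    obtain ⟨z, hz, hy⟩ := mem_mul.1 h2
    have : z = y := val_unique hz hxy
    subst this
    exact val_inj hz hy
  · intro hp
    ext x y
    rw [mem_mul]
    constructor
    · rintro ⟨z, hz, hy⟩
      obtain rfl := hp _ _ hz
      exact hy
    · intro h
      obtain rfl := hp _ _ h
      exact ⟨x, h, h⟩

end LeftHull

open LeftHull

variable (S) in
/-- The semigroup of idempotents of the left inverse hull. -/
def Idem : Type u := {p : LeftHull S // IsIdempotentElem p}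

namespace Idem

theorem eq_of_mem (p : Idem S) {x y : S} (h : y ∈ p.1.1 x) : x = y :=
  isIdempotentElem_iff.1 p.2 x y h

theorem ext' {p q : Idem S} (H : ∀ x, x ∈ p.1.1 x ↔ x ∈ q.1.1 x) : p = q := by
  apply Subtype.ext
  ext x y
  constructor
  · intro h; obtain rfl := p.eq_of_mem h; exact (H x).1 h
  · intro h; obtain rfl := q.eq_of_mem h; exact (H x).2 h

noncomputable instance : Mul (Idem S) where
  mul p q := ⟨p.1 * q.1, isIdempotentElem_iff.2 fun x y h => by
    obtain ⟨z, hz, hy⟩ := mem_mul.1 h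
    obtain rfl := q.eq_of_mem hz
    exact p.eq_of_mem hy⟩

noncomputable instance : One (Idem S) := ⟨⟨1, mul_one 1⟩⟩

theorem mem_mul_iff {p q : Idem S} {x : S} :
    x ∈ (p * q).1.1 x ↔ x ∈ p.1.1 x ∧ x ∈ q.1.1 x := by
  change x ∈ (p.1 * q.1).1 x ↔ _
  rw [mem_mul]
  constructor
  · rintro ⟨z, hz, hx⟩
    obtain rfl := q.eq_of_mem hz
    exact ⟨hx, hz⟩
  · rintro ⟨h, h'⟩; exact ⟨x, h', h⟩

theorem mem_one_iff {x : S} : x ∈ (1 : Idem S).1.1 x := mem_one.2 rfl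

theorem mul_comm' (p q : Idem S) : p * q = q * p :=
  ext' fun x => by rw [mem_mul_iff, mem_mul_iff, and_comm]

theorem one_mul' (p : Idem S) : 1 * p = p :=
  ext' fun x => by rw [mem_mul_iff]; exact ⟨fun h => h.2, fun h => ⟨mem_one_iff, h⟩⟩

/-- The idempotent `g⁻¹ p g`. -/
noncomputable def conj (g : LeftHull S) (p : Idem S) : Idem S :=
  ⟨g⁻¹ * p.1 * g, isIdempotentElem_iff.2 fun x y h => by
    obtain ⟨z, hz, hy⟩ := mem_mul.1 h
    obtain ⟨w, hw, hy⟩ := mem_mul.1 hy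
    obtain rfl := p.eq_of_mem hw
    exact val_inj hz (mem_inv.1 hy)⟩

theorem mem_conj {g : LeftHull S} {p : Idem S} {x : S} :
    x ∈ (conj g p).1.1 x ↔ ∃ y, y ∈ g.1 x ∧ y ∈ p.1.1 y := by
  change x ∈ (g⁻¹ * p.1 * g).1 x ↔ _
  rw [mem_mul]
  constructor
  · rintro ⟨z, hz, h⟩
    obtain ⟨w, hw, h⟩ := mem_mul.1 h
    obtain rfl := p.eq_of_mem hw
    exact ⟨z, hz, hw⟩
  · rintro ⟨y, hy, h⟩
    exact ⟨y, hy, mem_mul.2 ⟨y, h, mem_inv.2 hy⟩⟩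

/-- The source idempotent `g⁻¹ g`, the identity map of the domain of `g`. -/
noncomputable def dom (g : LeftHull S) : Idem S :=
  ⟨g⁻¹ * g, isIdempotentElem_iff.2 fun x y h => by
    obtain ⟨z, hz, hy⟩ := mem_mul.1 h
    exact val_inj hz (mem_inv.1 hy)⟩

theorem mem_dom {g : LeftHull S} {x : S} : x ∈ (dom g).1.1 x ↔ ∃ y, y ∈ g.1 x := by
  change x ∈ (g⁻¹ * g).1 x ↔ _
  rw [mem_mul]
  exact ⟨fun ⟨z, hz, _⟩ => ⟨z, hz⟩, fun ⟨z, hz⟩ => ⟨z, hz, mem_inv.2 hz⟩⟩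

theorem conj_one (g : LeftHull S) : conj g 1 = dom g :=
  ext' fun x => by
    rw [mem_conj, mem_dom]
    exact ⟨fun ⟨y, hy, _⟩ => ⟨y, hy⟩, fun ⟨y, hy⟩ => ⟨y, hy, mem_one_iff⟩⟩

theorem conj_mul' (g : LeftHull S) (p q : Idem S) : conj g (p * q) = conj g p * conj g q :=
  ext' fun x => by
    rw [mem_mul_iff, mem_conj, mem_conj, mem_conj]
    constructor
    · rintro ⟨y, hy, h⟩
      exact ⟨⟨y, hy, (mem_mul_iff.1 h).1⟩, ⟨y, hy, (mem_mul_iff.1 h).2⟩⟩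
    · rintro ⟨⟨y, hy, h⟩, ⟨z, hz, h'⟩⟩
      obtain rfl := val_unique hy hz
      exact ⟨y, hy, mem_mul_iff.2 ⟨h, h'⟩⟩

theorem conj_conj (g h : LeftHull S) (p : Idem S) : conj h (conj g p) = conj (g * h) p :=
  ext' fun x => by
    simp only [mem_conj, mem_mul]
    constructor
    · rintro ⟨y, hy, z, hz, h⟩; exact ⟨z, ⟨y, hy, hz⟩, h⟩
    · rintro ⟨z, ⟨y, hy, hz⟩, h⟩; exact ⟨y, hy, z, hz, h⟩

theorem conj_dom (g h : LeftHull S) : conj h (dom g) = dom (g * h) := by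
  rw [← conj_one, ← conj_one, conj_conj]

theorem dom_idem (p : Idem S) : dom p.1 = p := ext' fun x => by
  rw [mem_dom]
  exact ⟨fun ⟨y, hy⟩ => by have := p.eq_of_mem hy; subst this; exact hy, fun h => ⟨x, h⟩⟩

theorem conj_idem (p q : Idem S) : conj p.1 q = p * q := ext' fun x => by
  rw [mem_conj, mem_mul_iff]
  constructor
  · rintro ⟨y, hy, h⟩
    obtain rfl := p.eq_of_mem hy
    exact ⟨hy, h⟩
  · rintro ⟨h, h'⟩; exact ⟨x, h, h'⟩

/-- If `g` and `h` agree on the idempotent `p`, then so do their conjugations. -/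
theorem conj_mul_congr {g h : LeftHull S} {p : Idem S} (H : g * p.1 = h * p.1) (q : Idem S) :
    p * conj g q = p * conj h q := by
  rw [← conj_idem, ← conj_idem, conj_conj, conj_conj, H]

theorem dom_mul_congr {g h : LeftHull S} {p : Idem S} (H : g * p.1 = h * p.1) :
    p * dom g = p * dom h := by
  rw [← conj_one, ← conj_one, conj_mul_congr H]

end Idem

open Idem

variable (S) in
/-- The set of semi-characters of the semigroup of idempotents: multiplicative maps to `{0,1}`
that are not identically zero. It carries the topology of pointwise convergence. -/
def semiChars : Set (Idem S → Bool) :=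
  {χ | (∀ p q, χ (p * q) = (χ p && χ q)) ∧ ∃ p, χ p = true}

namespace semiChars

theorem map_mul (χ : semiChars S) (p q : Idem S) : χ.1 (p * q) = (χ.1 p && χ.1 q) := χ.2.1 p q

theorem map_mul_iff (χ : semiChars S) (p q : Idem S) :
    χ.1 (p * q) = true ↔ χ.1 p = true ∧ χ.1 q = true := by
  rw [map_mul, Bool.and_eq_true]

theorem map_one (χ : semiChars S) : χ.1 1 = true := by
  obtain ⟨p, hp⟩ := χ.2.2
  rw [← one_mul' p, map_mul_iff] at hp
  exact hp.1

theorem ext' {χ ψ : semiChars S} (h : ∀ p, χ.1 p = true ↔ ψ.1 p = true) : χ = ψ :=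
  Subtype.ext (funext fun p => Bool.eq_iff_iff.2 (h p))

theorem isClosed : IsClosed (semiChars S) := by
  have : semiChars S = (⋂ p, ⋂ q, {χ : Idem S → Bool | χ (p * q) = (χ p && χ q)}) ∩
      {χ | χ 1 = true} := by
    ext χ
    constructor
    · intro h
      refine ⟨?_, map_one ⟨χ, h⟩⟩
      simp only [Set.mem_iInter]
      exact h.1
    · rintro ⟨h, h'⟩
      simp only [Set.mem_iInter] at h
      exact ⟨h, 1, h'⟩
  rw [this]
  refine IsClosed.inter (isClosed_iInter fun p => isClosed_iInter fun q => ?_) ?_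
  · refine isClosed_eq (continuous_apply _) ?_
    have h1 : Continuous fun χ : Idem S → Bool => (χ p, χ q) :=
      (continuous_apply p).prodMk (continuous_apply q)
    have h2 : Continuous fun x : Bool × Bool => (x.1 && x.2) := continuous_of_discreteTopology
    exact h2.comp h1
  · exact isClosed_eq (continuous_apply _) continuous_const

/-- The semi-character `χ(g⁻¹ · g)`. -/
noncomputable def act (g : LeftHull S) (χ : semiChars S) (h : χ.1 (dom g) = true) : semiChars S :=
  ⟨fun p => χ.1 (conj g p), fun p q => by simp only [conj_mul', map_mul], 1,
    by simp only [conj_one, h]⟩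

/-- The semi-character `χ_s`, with `χ_s(p_X) = 1` if and only if `s ∈ X`. -/
noncomputable def point (s : S) : semiChars S :=
  ⟨fun p => (p.1.1 s).isSome, fun p q => by
    have key : ∀ r : Idem S, (r.1.1 s).isSome = true ↔ s ∈ r.1.1 s := fun r => by
      rw [Option.isSome_iff_exists]
      exact ⟨fun ⟨y, hy⟩ => by obtain rfl := r.eq_of_mem hy; exact hy, fun h => ⟨s, h⟩⟩
    rw [Bool.eq_iff_iff, Bool.and_eq_true, key, key, key, mem_mul_iff], 1, rfl⟩

theorem point_iff {s : S} {p : Idem S} : (point s).1 p = true ↔ s ∈ p.1.1 s := by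
  change (p.1.1 s).isSome = true ↔ _
  rw [Option.isSome_iff_exists]
  exact ⟨fun ⟨y, hy⟩ => by obtain rfl := p.eq_of_mem hy; exact hy, fun h => ⟨s, h⟩⟩

theorem act_apply {g : LeftHull S} {χ : semiChars S} (h : χ.1 (dom g) = true) (p : Idem S) :
    (act g χ h).1 p = χ.1 (conj g p) := rfl

theorem act_congr {g h : LeftHull S} {χ : semiChars S} (hg : χ.1 (dom g) = true)
    (hh : χ.1 (dom h) = true) {p : Idem S} (H : g * p.1 = h * p.1) (hp : χ.1 p = true) :
    act g χ hg = act h χ hh := by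
  refine ext' fun q => ?_
  rw [act_apply, act_apply]
  have := congrArg χ.1 (conj_mul_congr H q)
  rw [map_mul, map_mul, hp, Bool.true_and, Bool.true_and] at this
  rw [this]

theorem dom_mul_iff (g h : LeftHull S) (χ : semiChars S) : χ.1 (dom (g * h)) = true ↔
    ∃ hh : χ.1 (dom h) = true, (act h χ hh).1 (dom g) = true := by
  have e : dom (g * h) = dom h * dom (g * h) := by
    rw [← conj_dom, ← conj_one h, ← conj_mul', one_mul']
  constructor
  · intro H
    have H' := H
    rw [e, map_mul_iff] at H'
    exact ⟨H'.1, by rw [act_apply, conj_dom, H]⟩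
  · rintro ⟨hh, H⟩
    rwa [act_apply, conj_dom] at H

theorem act_act {g h : LeftHull S} {χ : semiChars S} (hh : χ.1 (dom h) = true)
    (hg : (act h χ hh).1 (dom g) = true) (hgh : χ.1 (dom (g * h)) = true) :
    act g (act h χ hh) hg = act (g * h) χ hgh :=
  ext' fun p => by rw [act_apply, act_apply, act_apply, conj_conj]

theorem act_idem (p : Idem S) (χ : semiChars S) (h : χ.1 (dom p.1) = true) :
    act p.1 χ h = χ := ext' fun q => by
  rw [dom_idem] at h
  rw [act_apply, conj_idem, map_mul_iff]
  exact ⟨fun H => H.2, fun H => ⟨h, H⟩⟩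

theorem dom_inv_act {g : LeftHull S} {χ : semiChars S} (h : χ.1 (dom g) = true) :
    (act g χ h).1 (dom g⁻¹) = true := by
  rw [act_apply, conj_dom]
  have : dom (g⁻¹ * g) = dom g := dom_idem (dom g)
  rw [this, h]

theorem act_inv_act {g : LeftHull S} {χ : semiChars S} (h : χ.1 (dom g) = true) :
    act g⁻¹ (act g χ h) (dom_inv_act h) = χ := by
  have h2 : χ.1 (dom (g⁻¹ * g)) = true := (dom_mul_iff _ _ _).2 ⟨h, dom_inv_act h⟩
  rw [act_act h (dom_inv_act h) h2]
  exact act_idem (dom g) χ h2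

theorem act_point {g : LeftHull S} {s t : S} (hs : t ∈ g.1 s)
    (h : (point s).1 (dom g) = true) : act g (point s) h = point t := ext' fun p => by
  rw [act_apply, point_iff, point_iff, mem_conj]
  constructor
  · rintro ⟨y, hy, hp⟩; obtain rfl := val_unique hy hs; exact hp
  · intro hp; exact ⟨t, hs, hp⟩

theorem isClopen_eval (p : Idem S) : IsClopen {χ : semiChars S | χ.1 p = true} :=
  (isClopen_discrete {true}).preimage ((continuous_apply p).comp continuous_subtype_val)

theorem continuous_act (g : LeftHull S) :
    Continuous fun χ : {χ : semiChars S | χ.1 (dom g) = true} => act g χ.1 χ.2 := by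
  refine Continuous.subtype_mk (continuous_pi fun p => ?_) _
  exact (continuous_apply (conj g p)).comp (continuous_subtype_val.comp continuous_subtype_val)

variable (S) in
/-- The closed set `Ω(S)`: the closure of the set of semi-characters `χ_s`, `s ∈ S`, which is
the orbit of `χ_e` under the left inverse hull. -/
def omega : Set (semiChars S) := closure (Set.range point)

theorem act_mem_omega {g : LeftHull S} {χ : semiChars S} (h : χ.1 (dom g) = true)
    (hχ : χ ∈ omega S) : act g χ h ∈ omega S := by
  rw [omega, mem_closure_iff]
  intro O hO hmem
  obtain ⟨W, hW, hWO⟩ := isOpen_induced_iff.1 (hO.preimage (continuous_act g))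
  have hχW : χ ∈ W ∩ {χ : semiChars S | χ.1 (dom g) = true} := by
    refine ⟨?_, h⟩
    have : (⟨χ, h⟩ : {χ : semiChars S | χ.1 (dom g) = true}) ∈ Subtype.val ⁻¹' W := by
      rw [hWO]; exact hmem
    exact this
  obtain ⟨_, ⟨hsW, hsd⟩, s, rfl⟩ :=
    mem_closure_iff.1 hχ _ (hW.inter (isClopen_eval (dom g)).isOpen) hχW
  have hsd' : (point s).1 (dom g) = true := hsd
  have : (⟨point s, hsd'⟩ : {χ : semiChars S | χ.1 (dom g) = true}) ∈ Subtype.val ⁻¹' W := hsW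
  rw [hWO] at this
  obtain ⟨t, ht⟩ := mem_dom.1 (point_iff.1 hsd')
  exact ⟨_, this, t, (act_point ht hsd').symm⟩

end semiChars

end Hull

/-! ### The Paterson groupoid of the left inverse hull and its reduction to `Ω(S)` -/

section Groupoid

universe u

variable {S : Type u} [LeftCancelMonoid S]

open LeftHull Idem semiChars

variable (S) in
/-- The set of pairs `(g, χ)` with `χ(g⁻¹ g) = 1`. -/
def GermPair : Type u := {x : LeftHull S × semiChars S // x.2.1 (dom x.1) = true}

variable (S) in
/-- The equivalence relation defining germs: `(g₁, χ₁) ∼ (g₂, χ₂)` if `χ₁ = χ₂` and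
`g₁ p = g₂ p` for some idempotent `p` with `χ₁(p) = 1`. -/
def germSetoid : Setoid (GermPair S) where
  r x y := x.1.2 = y.1.2 ∧ ∃ p : Idem S, x.1.1 * p.1 = y.1.1 * p.1 ∧ x.1.2.1 p = true
  iseqv :=
    { refl := fun x => ⟨rfl, 1, rfl, map_one _⟩
      symm := fun ⟨h, p, hp, hx⟩ => ⟨h.symm, p, hp.symm, h ▸ hx⟩
      trans := by
        rintro x y z ⟨h, p, hp, hx⟩ ⟨h', q, hq, hy⟩
        refine ⟨h.trans h', p * q, ?_, (map_mul_iff _ _ _).2 ⟨hx, h ▸ hy⟩⟩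
        have e : (p * q).1 = p.1 * q.1 := rfl
        have e' : (p * q).1 = q.1 * p.1 := congrArg Subtype.val (Idem.mul_comm' p q)
        rw [e, ← mul_assoc, hp, mul_assoc, ← e, e', ← mul_assoc, hq, mul_assoc] }

variable (S) in
/-- The Paterson groupoid of the left inverse hull of `S`. -/
def Paterson : Type u := Quotient (germSetoid S)

namespace Paterson

/-- The class `[g, χ]`. -/
def germ (g : LeftHull S) (χ : semiChars S) (h : χ.1 (dom g) = true) : Paterson S :=
  Quotient.mk (germSetoid S) ⟨(g, χ), h⟩

theorem germ_eq_iff {g g' : LeftHull S} {χ χ' : semiChars S} {h : χ.1 (dom g) = true}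
    {h' : χ'.1 (dom g') = true} : germ g χ h = germ g' χ' h' ↔
      χ = χ' ∧ ∃ p : Idem S, g * p.1 = g' * p.1 ∧ χ.1 p = true :=
  Quotient.eq (r := germSetoid S)

theorem exists_germ (γ : Paterson S) : ∃ g χ h, γ = germ g χ h := by
  obtain ⟨⟨⟨g, χ⟩, h⟩, rfl⟩ := Quotient.exists_rep γ
  exact ⟨g, χ, h, rfl⟩

/-- The source map `[g, χ] ↦ χ`. -/
def src : Paterson S → semiChars S := Quotient.lift (fun x => x.1.2) fun _ _ h => h.1

/-- The range map `[g, χ] ↦ χ(g⁻¹ · g)`. -/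
noncomputable def rng : Paterson S → semiChars S :=
  Quotient.lift (fun x => act x.1.1 x.1.2 x.2) (by
    rintro ⟨⟨g, χ⟩, h⟩ ⟨⟨g', χ'⟩, h'⟩ ⟨e, p, hp, hx⟩
    obtain rfl : χ = χ' := e
    exact act_congr h h' hp hx)

theorem src_germ (g : LeftHull S) (χ : semiChars S) (h) : src (germ g χ h) = χ := rfl

theorem rng_germ (g : LeftHull S) (χ : semiChars S) (h) : rng (germ g χ h) = act g χ h := rfl

theorem inv_mul_congr {g h : LeftHull S} {p : Idem S} (H : g * p.1 = h * p.1) :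
    g⁻¹ * (conj g⁻¹ p).1 = h⁻¹ * (conj g⁻¹ p).1 := by
  have e : (conj g⁻¹ p).1 = g * p.1 * g⁻¹ := rfl
  have key : ∀ x y : S, x ∈ p.1.1 x → (y ∈ g.1 x ↔ y ∈ h.1 x) := fun x y hx => by
    have := congrArg (fun k : LeftHull S => y ∈ k.1 x) H
    simp only [mem_mul, eq_iff_iff] at this
    constructor
    · intro hy
      obtain ⟨z, hz, hy⟩ := this.1 ⟨x, hx, hy⟩
      obtain rfl := p.eq_of_mem hz
      exact hy
    · intro hy
      obtain ⟨z, hz, hy⟩ := this.2 ⟨x, hx, hy⟩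
      obtain rfl := p.eq_of_mem hz
      exact hy
  ext x y
  rw [mem_mul, mem_mul]
  refine exists_congr fun z => and_congr_right fun hz => ?_
  obtain rfl := (conj g⁻¹ p).eq_of_mem hz
  obtain ⟨w, hw, hwp⟩ := mem_conj.1 hz
  rw [mem_inv] at hw
  rw [mem_inv, mem_inv]
  have hw' := (key _ _ hwp).1 hw
  constructor
  · intro hy; obtain rfl := val_inj hw hy; exact hw'
  · intro hy; obtain rfl := val_inj hw' hy; exact hw

/-- The inverse `[g, χ] ↦ [g⁻¹, χ(g⁻¹ · g)]`. -/
noncomputable def inv : Paterson S → Paterson S :=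
  Quotient.lift (fun x => germ x.1.1⁻¹ (act x.1.1 x.1.2 x.2) (dom_inv_act x.2)) (by
    rintro ⟨⟨g, χ⟩, h⟩ ⟨⟨g', χ'⟩, h'⟩ ⟨e, p, hp, hx⟩
    obtain rfl : χ = χ' := e
    replace hp : g * p.1 = g' * p.1 := hp
    replace hx : χ.1 p = true := hx
    refine germ_eq_iff.2 ⟨act_congr h h' hp hx, conj g⁻¹ p, inv_mul_congr hp, ?_⟩
    change χ.1 (conj g (conj g⁻¹ p)) = true
    rw [conj_conj]
    change χ.1 (conj (dom g).1 p) = true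
    rw [conj_idem, map_mul_iff]
    exact ⟨h, hx⟩)

theorem inv_germ (g : LeftHull S) (χ : semiChars S) (h) :
    inv (germ g χ h) = germ g⁻¹ (act g χ h) (dom_inv_act h) := rfl

theorem src_inv (γ : Paterson S) : src (inv γ) = rng γ := by
  obtain ⟨g, χ, h, rfl⟩ := exists_germ γ
  rfl

theorem rng_inv (γ : Paterson S) : rng (inv γ) = src γ := by
  obtain ⟨g, χ, h, rfl⟩ := exists_germ γ
  exact act_inv_act h

theorem inv_inv (γ : Paterson S) : inv (inv γ) = γ := by
  obtain ⟨g, χ, h, rfl⟩ := exists_germ γ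
  exact germ_eq_iff.2 ⟨act_inv_act h, 1, rfl, map_one _⟩

theorem out_spec (γ : Paterson S) : ∃ h, γ = germ (Quotient.out γ).1.1 (src γ) h := by
  have e : germ (Quotient.out γ).1.1 (Quotient.out γ).1.2 (Quotient.out γ).2 = γ :=
    Quotient.out_eq γ
  have e2 : (Quotient.out γ).1.2 = src γ := congrArg src e
  refine ⟨e2 ▸ (Quotient.out γ).2, e.symm.trans ?_⟩
  exact germ_eq_iff.2 ⟨e2, 1, rfl, map_one _⟩

theorem dom_mul_out {a b : Paterson S} (h : src a = rng b) :
    (src b).1 (dom ((Quotient.out a).1.1 * (Quotient.out b).1.1)) = true := by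
  obtain ⟨ha, ea⟩ := out_spec a
  obtain ⟨hb, eb⟩ := out_spec b
  have e : src a = act _ _ hb := h.trans (congrArg rng eb)
  exact (dom_mul_iff _ _ _).2 ⟨hb, e ▸ ha⟩

/-- The product of composable elements: `[g, χ] [h, ψ] = [g h, ψ]` if `χ = ψ(h⁻¹ · h)`; see
`mul_germ` for independence of the representatives. -/
noncomputable def mul (a b : Paterson S) (h : src a = rng b) : Paterson S :=
  germ ((Quotient.out a).1.1 * (Quotient.out b).1.1) (src b) (dom_mul_out h)

theorem mul_germ {g h : LeftHull S} {χ ψ : semiChars S} (hg : χ.1 (dom g) = true)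
    (hh : ψ.1 (dom h) = true) (e : χ = act h ψ hh) (hgh : ψ.1 (dom (g * h)) = true) :
    mul (germ g χ hg) (germ h ψ hh) e = germ (g * h) ψ hgh := by
  obtain ⟨ha, ea⟩ := out_spec (germ g χ hg)
  obtain ⟨hb, eb⟩ := out_spec (germ h ψ hh)
  obtain ⟨-, p, hp, hpχ⟩ := germ_eq_iff.1 ea
  obtain ⟨-, q, hq, hqψ⟩ := germ_eq_iff.1 eb
  refine germ_eq_iff.2 ⟨rfl, q * conj h p, ?_, ?_⟩
  · set g' := (Quotient.out (germ g χ hg)).1.1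
    set h' := (Quotient.out (germ h ψ hh)).1.1
    have c : ∀ k : LeftHull S, k * (conj k p).1 = p.1 * k := fun k => by
      ext x y
      rw [mem_mul, mem_mul]
      constructor
      · rintro ⟨z, hz, hy⟩
        obtain rfl := (conj k p).eq_of_mem hz
        obtain ⟨w, hw, hwp⟩ := mem_conj.1 hz
        obtain rfl := val_unique hw hy
        exact ⟨w, hw, hwp⟩
      · rintro ⟨z, hz, hy⟩
        obtain rfl := p.eq_of_mem hy
        exact ⟨x, mem_conj.2 ⟨z, hz, hy⟩, hz⟩
    have e1 : (q * conj h p).1 = q.1 * (conj h p).1 := rfl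
    have e2 : (q * conj h p).1 = (conj h p).1 * q.1 := congrArg Subtype.val (Idem.mul_comm' _ _)
    calc g' * h' * (q * conj h p).1 = g' * (h' * q.1) * (conj h p).1 := by
          rw [e1]; simp only [mul_assoc]
      _ = g' * (h * q.1) * (conj h p).1 := by rw [hq]
      _ = g' * (h * (q * conj h p).1) := by rw [e1]; simp only [mul_assoc]
      _ = g' * (h * (conj h p).1) * q.1 := by rw [e2]; simp only [mul_assoc]
      _ = (g' * p.1) * h * q.1 := by rw [c]; simp only [mul_assoc]
      _ = (g * p.1) * h * q.1 := by rw [hp]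
      _ = g * (h * (conj h p).1) * q.1 := by rw [c]; simp only [mul_assoc]
      _ = g * h * (q * conj h p).1 := by rw [e2]; simp only [mul_assoc]
  · rw [src_germ, map_mul_iff]
    refine ⟨hqψ, ?_⟩
    rw [e] at hpχ
    exact hpχ

theorem src_mul (a b : Paterson S) (h : src a = rng b) : src (mul a b h) = src b := rfl

/-- `D(g, U)`: the set of all germs `[g, χ]` with `χ ∈ U`. -/
def basicSet (g : LeftHull S) (U : Set (semiChars S)) : Set (Paterson S) :=
  {γ | ∃ χ h, χ ∈ U ∧ γ = germ g χ h}

/-- The topology with basis the sets `D(g, U)`, where `U` is an open subset of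
`{χ | χ(g⁻¹ g) = 1}`. -/
instance : TopologicalSpace (Paterson S) :=
  TopologicalSpace.generateFrom
    {W | ∃ g U, IsOpen U ∧ U ⊆ {χ : semiChars S | χ.1 (dom g) = true} ∧ W = basicSet g U}

theorem isOpen_germ_preimage {W : Set (Paterson S)} (hW : IsOpen W) (g : LeftHull S) :
    IsOpen {χ : semiChars S | ∃ h, germ g χ h ∈ W} := by
  induction hW with
  | basic W hW =>
    obtain ⟨k, U, hU, -, rfl⟩ := hW
    have : {χ : semiChars S | ∃ h, germ g χ h ∈ basicSet k U} =
        ⋃ p ∈ {p : Idem S | g * p.1 = k * p.1}, (U ∩ {χ : semiChars S | χ.1 (dom g) = true} ∩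
          {χ : semiChars S | χ.1 (dom k) = true}) ∩ {χ : semiChars S | χ.1 p = true} := by
      ext χ
      simp only [Set.mem_ofPred_eq, Set.mem_iUnion, Set.mem_inter_iff, exists_prop, basicSet]
      constructor
      · rintro ⟨h, χ', h', hχ', e⟩
        obtain ⟨rfl, p, hp, hχp⟩ := germ_eq_iff.1 e
        exact ⟨p, hp, ⟨⟨hχ', h⟩, h'⟩, hχp⟩
      · rintro ⟨p, hp, ⟨⟨hχ, h⟩, h'⟩, hχp⟩
        exact ⟨h, χ, h', hχ, germ_eq_iff.2 ⟨rfl, p, hp, hχp⟩⟩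
    rw [this]
    exact isOpen_biUnion fun p _ => ((hU.inter (isClopen_eval _).isOpen).inter
      (isClopen_eval _).isOpen).inter (isClopen_eval _).isOpen
  | univ => simpa using (isClopen_eval (dom g)).isOpen
  | inter W W' _ _ h h' =>
    have : {χ : semiChars S | ∃ h, germ g χ h ∈ W ∩ W'} =
        {χ : semiChars S | ∃ h, germ g χ h ∈ W} ∩ {χ : semiChars S | ∃ h, germ g χ h ∈ W'} := by
      ext χ
      exact ⟨fun ⟨h, h1, h2⟩ => ⟨⟨h, h1⟩, ⟨h, h2⟩⟩, fun ⟨⟨h, h1⟩, ⟨_, h2⟩⟩ => ⟨h, h1, h2⟩⟩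
    rw [this]
    exact IsOpen.inter h h'
  | sUnion Ws _ ih =>
    have : {χ : semiChars S | ∃ h, germ g χ h ∈ ⋃₀ Ws} =
        ⋃ W ∈ Ws, {χ : semiChars S | ∃ h, germ g χ h ∈ W} := by
      ext χ
      simp only [Set.mem_ofPred_eq, Set.mem_sUnion, Set.mem_iUnion, exists_prop]
      exact ⟨fun ⟨h, W, hW, hm⟩ => ⟨W, hW, h, hm⟩, fun ⟨W, hW, h, hm⟩ => ⟨h, W, hW, hm⟩⟩
    rw [this]
    exact isOpen_biUnion ih

end Paterson

open Paterson

variable (S) in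
/-- The reduction `𝒢_P(S)` of the Paterson groupoid to the closed invariant set `Ω(S)`, with
the relative topology. -/
def GP : Type u := {γ : Paterson S // src γ ∈ omega S}

namespace GP

instance : TopologicalSpace (GP S) := inferInstanceAs (TopologicalSpace (Subtype _))

theorem rng_mem (γ : GP S) : Paterson.rng γ.1 ∈ omega S := by
  obtain ⟨⟨g, χ, h, e⟩, hγ⟩ := And.intro (exists_germ γ.1) γ.2
  rw [e] at hγ ⊢
  exact act_mem_omega h hγ

/-- The source map, with values in the unit space `Ω(S)`. -/
def src (γ : GP S) : omega S := ⟨Paterson.src γ.1, γ.2⟩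

/-- The range map, with values in the unit space `Ω(S)`. -/
noncomputable def rng (γ : GP S) : omega S := ⟨Paterson.rng γ.1, γ.rng_mem⟩

/-- The inverse, restricted to the reduction. -/
noncomputable def inv (γ : GP S) : GP S :=
  ⟨Paterson.inv γ.1, (Paterson.src_inv γ.1).symm ▸ γ.rng_mem⟩

/-- The product of composable elements, restricted to the reduction. -/
noncomputable def mul (a b : GP S) (h : src a = rng b) : GP S :=
  ⟨Paterson.mul a.1 b.1 (congrArg Subtype.val h), b.2⟩

/-- The class `[g, χ]` with `χ ∈ Ω(S)`. -/
def germ (g : LeftHull S) (χ : omega S) (h : χ.1.1 (dom g) = true) : GP S :=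
  ⟨Paterson.germ g χ.1 h, χ.2⟩

/-- `D(g, Ω(S))`: the set of all germs `[g, χ]` with `χ ∈ Ω(S)`. -/
def bisection (g : LeftHull S) : Set (GP S) := {γ | ∃ χ h, γ = germ g χ h}

theorem src_inv (γ : GP S) : src (inv γ) = rng γ := Subtype.ext (Paterson.src_inv γ.1)

theorem rng_inv (γ : GP S) : rng (inv γ) = src γ := Subtype.ext (Paterson.rng_inv γ.1)

theorem inv_inv (γ : GP S) : inv (inv γ) = γ := Subtype.ext (Paterson.inv_inv γ.1)

/-- Convolution of functions on the groupoid: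
`(f₁ * f₂)(γ) = ∑ f₁(η) f₂(η⁻¹ γ)`, the sum being over all `η` with `r(η) = r(γ)`. -/
noncomputable def conv (f₁ f₂ : GP S → ℂ) (γ : GP S) : ℂ :=
  ∑ᶠ η : {η : GP S // rng η = rng γ}, f₁ η.1 * f₂ (mul (inv η.1) γ ((src_inv η.1).trans η.2))

/-- The involution `f*(γ) = conj f(γ⁻¹)`. -/
noncomputable def invol (f : GP S → ℂ) (γ : GP S) : ℂ := star (f (inv γ))

end GP

/-- The space `C_c(X)` of a not necessarily Hausdorff space `X`: the linear span, in the space of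
all functions on `X`, of the continuous compactly supported functions on open Hausdorff subsets
`V` of `X`, extended by zero. -/
def Cc (X : Type*) [TopologicalSpace X] : Submodule ℂ (X → ℂ) :=
  Submodule.span ℂ {f | ∃ V : Set X, IsOpen V ∧ T2Space V ∧ ContinuousOn f V ∧
    ∃ K ⊆ V, IsCompact K ∧ ∀ x ∉ K, f x = 0}

namespace GP

theorem exists_germ (γ : GP S) : ∃ g χ h, γ = germ g χ h := by
  obtain ⟨g, χ, h, e⟩ := Paterson.exists_germ γ.1
  exact ⟨g, ⟨χ, by have := γ.2; rw [e] at this; exact this⟩, h, Subtype.ext e⟩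

theorem germ_eq_iff {g g' : LeftHull S} {χ χ' : omega S} {h : χ.1.1 (dom g) = true}
    {h' : χ'.1.1 (dom g') = true} : germ g χ h = germ g' χ' h' ↔
      χ = χ' ∧ ∃ p : Idem S, g * p.1 = g' * p.1 ∧ χ.1.1 p = true :=
  Subtype.ext_iff.trans (Paterson.germ_eq_iff.trans (and_congr_left fun _ => Subtype.ext_iff.symm))

theorem src_germ (g : LeftHull S) (χ : omega S) (h) : src (germ g χ h) = χ := rfl

/-- The action of `g` on `Ω(S)`. -/
noncomputable def actΩ (g : LeftHull S) (χ : omega S) (h : χ.1.1 (dom g) = true) : omega S :=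
  ⟨act g χ.1 h, act_mem_omega h χ.2⟩

theorem rng_germ (g : LeftHull S) (χ : omega S) (h) : rng (germ g χ h) = actΩ g χ h := rfl

theorem actΩ_injective {g : LeftHull S} {χ χ' : omega S} {h h'} (e : actΩ g χ h = actΩ g χ' h') :
    χ = χ' := by
  apply Subtype.ext
  have e' : act g χ.1 h = act g χ'.1 h' := congrArg Subtype.val e
  rw [← act_inv_act h, ← act_inv_act h']
  congr 1

theorem mul_germ {g h : LeftHull S} {χ ψ : omega S} (hg : χ.1.1 (dom g) = true)
    (hh : ψ.1.1 (dom h) = true) (e : χ = actΩ h ψ hh) (hgh : ψ.1.1 (dom (g * h)) = true) :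
    mul (germ g χ hg) (germ h ψ hh) e = germ (g * h) ψ hgh :=
  Subtype.ext (Paterson.mul_germ hg hh (congrArg Subtype.val e) hgh)

theorem inv_germ (g : LeftHull S) (χ : omega S) (h) :
    inv (germ g χ h) = germ g⁻¹ (actΩ g χ h) (dom_inv_act h) := rfl

theorem mem_bisection_iff {g : LeftHull S} {γ : GP S} :
    γ ∈ bisection g ↔ ∃ h, γ = germ g (src γ) h :=
  ⟨fun ⟨_, h, e⟩ => by subst e; exact ⟨h, rfl⟩, fun ⟨h, e⟩ => ⟨_, h, e⟩⟩

theorem germ_mem_bisection (g : LeftHull S) (χ : omega S) (h) : germ g χ h ∈ bisection g :=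
  ⟨χ, h, rfl⟩

theorem germ_inv_mul {g k : LeftHull S} {χ : omega S} (h : χ.1.1 (dom (g⁻¹ * k)) = true)
    (h1 : χ.1.1 (dom (g * (g⁻¹ * k))) = true) (h2 : χ.1.1 (dom k) = true) :
    germ (g * (g⁻¹ * k)) χ h1 = germ k χ h2 := by
  refine germ_eq_iff.2 ⟨rfl, dom (g⁻¹ * k), ?_, h⟩
  ext x y
  rw [mem_mul, mem_mul]
  refine exists_congr fun z => and_congr_right fun hz => ?_
  obtain rfl := (dom (g⁻¹ * k)).eq_of_mem hz
  obtain ⟨w, hw⟩ := mem_dom.1 hz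
  obtain ⟨v, hv, hw'⟩ := mem_mul.1 hw
  rw [mem_mul]
  constructor
  · rintro ⟨w', hw', hy⟩
    obtain rfl := val_unique hw hw'
    obtain ⟨v', hv', hw''⟩ := mem_mul.1 hw'
    obtain rfl := val_unique (mem_inv.1 hw'') hy
    exact hv'
  · intro hy
    obtain rfl := val_unique hv hy
    exact ⟨w, hw, mem_inv.1 hw'⟩


theorem dom_inv_mul {g h : LeftHull S} {χ : semiChars S} (H : χ.1 (dom (g * h)) = true) :
    χ.1 (dom (g⁻¹ * (g * h))) = true := by
  have e : dom (g⁻¹ * (g * h)) = dom (g * h) := by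
    apply Idem.ext'
    intro x
    rw [mem_dom, mem_dom]
    constructor
    · rintro ⟨y, hy⟩
      obtain ⟨z, hz, _⟩ := mem_mul.1 hy
      exact ⟨z, hz⟩
    · rintro ⟨z, hz⟩
      obtain ⟨w, hw, hz'⟩ := mem_mul.1 hz
      exact ⟨w, mem_mul.2 ⟨z, hz, mem_inv.2 hz'⟩⟩
  rw [e, H]

open Classical in
/-- The function supported on `D(g, Ω(S))` with `[g, χ] ↦ φ(χ)`. -/
noncomputable def delta (g : LeftHull S) (φ : C(omega S, ℂ)) (γ : GP S) : ℂ :=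
  if γ ∈ bisection g then φ (src γ) else 0

theorem delta_germ (g : LeftHull S) (φ : C(omega S, ℂ)) (χ : omega S) (h) :
    delta g φ (germ g χ h) = φ χ := by
  rw [delta, if_pos (germ_mem_bisection g χ h), src_germ]

theorem delta_of_notMem {g : LeftHull S} (φ : C(omega S, ℂ)) {γ : GP S} (h : γ ∉ bisection g) :
    delta g φ γ = 0 := if_neg h

theorem mem_of_delta_ne {g : LeftHull S} {φ : C(omega S, ℂ)} {γ : GP S} (h : delta g φ γ ≠ 0) :
    γ ∈ bisection g := by
  by_contra h'
  exact h (delta_of_notMem φ h')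

theorem delta_congr {g : LeftHull S} {φ ψ : C(omega S, ℂ)}
    (H : ∀ χ : omega S, χ.1.1 (dom g) = true → φ χ = ψ χ) : delta g φ = delta g ψ := by
  funext γ
  by_cases h : γ ∈ bisection g
  · obtain ⟨χ, hχ, rfl⟩ := h
    rw [delta_germ, delta_germ, H χ hχ]
  · rw [delta_of_notMem φ h, delta_of_notMem ψ h]

theorem isClopen_domΩ (p : Idem S) : IsClopen {χ : omega S | χ.1.1 p = true} :=
  (isClopen_eval p).preimage continuous_subtype_val

theorem continuous_actΩ (g : LeftHull S) :
    Continuous fun χ : {χ : omega S | χ.1.1 (dom g) = true} => actΩ g χ.1 χ.2 := by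
  refine Continuous.subtype_mk ?_ _
  exact (continuous_act g).comp
    ((continuous_subtype_val.comp continuous_subtype_val).subtype_mk fun χ => χ.2)

open Classical in
/-- Extension by zero of a continuous function from a clopen set. -/
theorem continuous_extend {X : Type*} [TopologicalSpace X] {P : X → Prop}
    (hP : IsClopen {x | P x}) (F : ∀ x, P x → ℂ)
    (hF : Continuous fun x : {x | P x} => F x.1 x.2) :
    Continuous fun x => if h : P x then F x h else 0 := by
  rw [continuous_iff_continuousAt]
  intro x
  by_cases hx : P x
  · have h1 : ContinuousOn (fun x => if h : P x then F x h else 0) {x | P x} := by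
      rw [continuousOn_iff_continuous_domRestrict]
      convert hF using 2 with y
      exact dif_pos y.2
    exact h1.continuousAt (hP.isOpen.mem_nhds hx)
  · have : (fun _ => (0 : ℂ)) =ᶠ[nhds x] fun x => if h : P x then F x h else 0 := by
      filter_upwards [hP.compl.isOpen.mem_nhds hx] with y hy
      have hy' : ¬ P y := hy
      simp only [hy', dite_false]
    exact continuousAt_const.congr this

open Classical in
/-- The function `χ ↦ φ(χ(g⁻¹ · g))` on `{χ | χ(g⁻¹ g) = 1}`, extended by zero. -/
noncomputable def pull (g : LeftHull S) (φ : C(omega S, ℂ)) : C(omega S, ℂ) where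
  toFun χ := if h : χ.1.1 (dom g) = true then φ (actΩ g χ h) else 0
  continuous_toFun := by
    convert! continuous_extend (isClopen_domΩ (dom g)) (fun χ h => φ (actΩ g χ h))
      (φ.continuous.comp (continuous_actΩ g))

theorem pull_pos {g : LeftHull S} (φ : C(omega S, ℂ)) {χ : omega S} (h : χ.1.1 (dom g) = true) :
    pull g φ χ = φ (actΩ g χ h) := dif_pos h

theorem pull_neg {g : LeftHull S} (φ : C(omega S, ℂ)) {χ : omega S} (h : ¬ χ.1.1 (dom g) = true) :
    pull g φ χ = 0 := dif_neg h

theorem pull_mul (g : LeftHull S) (φ ψ : C(omega S, ℂ)) :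
    pull g (φ * ψ) = pull g φ * pull g ψ := by
  ext χ
  by_cases h : χ.1.1 (dom g) = true
  · simp [pull_pos _ h]
  · simp [pull_neg _ h]

theorem pull_star (g : LeftHull S) (φ : C(omega S, ℂ)) : pull g (star φ) = star (pull g φ) := by
  ext χ
  by_cases h : χ.1.1 (dom g) = true
  · simp [pull_pos _ h]
  · simp [pull_neg _ h]

theorem pull_pull (g h : LeftHull S) (φ : C(omega S, ℂ)) :
    pull h (pull g φ) = pull (g * h) φ := by
  ext χ
  by_cases H : χ.1.1 (dom (g * h)) = true
  · obtain ⟨hh, hg⟩ := (dom_mul_iff _ _ _).1 H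
    rw [pull_pos _ H, pull_pos _ hh, pull_pos (χ := actΩ h χ hh) _ hg]
    congr 1
    exact Subtype.ext (act_act hh hg H)
  · rw [pull_neg _ H]
    by_cases hh : χ.1.1 (dom h) = true
    · rw [pull_pos _ hh, pull_neg]
      intro hg
      exact H ((dom_mul_iff _ _ _).2 ⟨hh, hg⟩)
    · rw [pull_neg _ hh]

theorem pull_idem (p : Idem S) (φ : C(omega S, ℂ)) {χ : omega S} (h : χ.1.1 p = true) :
    pull p.1 φ χ = φ χ := by
  have h' : χ.1.1 (dom p.1) = true := by rw [dom_idem, h]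
  rw [pull_pos _ h']
  congr 1
  exact Subtype.ext (act_idem p χ.1 h')

theorem inv_mul_germ {g k : LeftHull S} {χ' χ : omega S} (h' : χ'.1.1 (dom g) = true)
    (hk : χ.1.1 (dom k) = true) (e) (hgk : χ.1.1 (dom (g⁻¹ * k)) = true) :
    mul (inv (germ g χ' h')) (germ k χ hk) e = germ (g⁻¹ * k) χ hgk :=
  Subtype.ext (Paterson.mul_germ (dom_inv_act h') hk (congrArg Subtype.val e) hgk)

theorem conv_delta (g h : LeftHull S) (φ ψ : C(omega S, ℂ)) :
    conv (delta g φ) (delta h ψ) = delta (g * h) (pull h φ * ψ) := by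
  funext γ
  by_cases hγ : γ ∈ bisection (g * h)
  · obtain ⟨χ, H, rfl⟩ := hγ
    obtain ⟨hh, hg⟩ := (dom_mul_iff _ _ _).1 H
    replace hg : (actΩ h χ hh).1.1 (dom g) = true := hg
    have er : rng (germ g (actΩ h χ hh) hg) = rng (germ (g * h) χ H) :=
      Subtype.ext (act_act hh hg H)
    have e1 : mul (inv (germ g (actΩ h χ hh) hg)) (germ (g * h) χ H)
        ((src_inv _).trans er) = germ h χ hh := by
      rw [inv_mul_germ hg H _ (dom_inv_mul H)]
      exact germ_inv_mul (g := g⁻¹) H (dom_inv_mul H) hh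
    rw [conv, finsum_eq_single _ (⟨germ g (actΩ h χ hh) hg, er⟩ : {η // rng η = _})]
    · simp only [e1]
      rw [delta_germ, delta_germ, delta_germ, ContinuousMap.mul_apply, pull_pos _ hh]
    · rintro ⟨η, hη⟩ hne
      rw [delta_of_notMem, zero_mul]
      rintro ⟨χ', h', rfl⟩
      apply hne
      have e2 : actΩ g χ' h' = actΩ g (actΩ h χ hh) hg := hη.trans er.symm
      obtain rfl := actΩ_injective e2
      rfl
  · rw [delta_of_notMem _ hγ, conv]
    apply finsum_eq_zero_of_forall_eq_zero
    rintro ⟨η, hη⟩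
    by_contra hne
    obtain ⟨χ', h', rfl⟩ := mem_of_delta_ne (left_ne_zero_of_mul hne)
    obtain ⟨χ'', h'', e⟩ := mem_of_delta_ne (right_ne_zero_of_mul hne)
    obtain ⟨k, χ, hk, rfl⟩ := exists_germ γ
    have hη' : actΩ g χ' h' = actΩ k χ hk := hη
    have hgk : χ.1.1 (dom (g⁻¹ * k)) = true := by
      refine (dom_mul_iff _ _ _).2 ⟨hk, ?_⟩
      have : act k χ.1 hk = act g χ'.1 h' := (congrArg Subtype.val hη').symm
      rw [this]
      exact dom_inv_act h'
    have e2 : germ (g⁻¹ * k) χ hgk = germ h χ'' h'' :=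
      (inv_mul_germ h' hk _ hgk).symm.trans e
    obtain ⟨rfl, p, hp, hχp⟩ := germ_eq_iff.1 e2
    have hgk2 : χ.1.1 (dom (g * (g⁻¹ * k))) = true := dom_inv_mul (g := g⁻¹) hgk
    have e3 := germ_inv_mul hgk hgk2 hk
    have hgh : χ.1.1 (dom (g * h)) = true := by
      have := dom_mul_congr (g := g * (g⁻¹ * k)) (h := g * h) (p := p)
        (by rw [mul_assoc, hp, mul_assoc])
      have := congrArg χ.1.1 this
      rw [semiChars.map_mul, semiChars.map_mul, hχp, hgk2] at this
      simpa using this.symm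
    apply hγ
    refine ⟨χ, hgh, e3.symm.trans (germ_eq_iff.2 ⟨rfl, p, ?_, hχp⟩)⟩
    rw [mul_assoc, hp, mul_assoc]

theorem invol_delta (g : LeftHull S) (φ : C(omega S, ℂ)) :
    invol (delta g φ) = delta g⁻¹ (pull g⁻¹ (star φ)) := by
  funext γ
  by_cases h : γ ∈ bisection g⁻¹
  · obtain ⟨χ, hχ, rfl⟩ := h
    rw [invol, inv_germ, delta_germ, pull_pos _ hχ]
    congr 1
    exact delta_germ g φ _ _
  · rw [delta_of_notMem _ h, invol, delta_of_notMem, star_zero]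
    rintro ⟨χ, hχ, e⟩
    apply h
    rw [← inv_inv γ, e]
    exact germ_mem_bisection g⁻¹ (actΩ g χ hχ) (dom_inv_act hχ)

/-! Bilinearity of the convolution on functions with finite supports in the range fibres. -/

/-- Functions whose restriction to every range fibre has finite support. -/
def FiberFinite (f : GP S → ℂ) : Prop := ∀ x : omega S, {η : GP S | rng η = x ∧ f η ≠ 0}.Finite

theorem fiberFinite_delta (g : LeftHull S) (φ : C(omega S, ℂ)) : FiberFinite (delta g φ) := by
  intro x
  apply Set.Subsingleton.finite
  rintro η ⟨hη, hne⟩ η' ⟨hη', hne'⟩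
  obtain ⟨χ, h, rfl⟩ := mem_of_delta_ne (S := S) (g := g) (φ := φ) hne
  obtain ⟨χ', h', rfl⟩ := mem_of_delta_ne (S := S) (g := g) (φ := φ) hne'
  have : actΩ g χ h = actΩ g χ' h' := hη.trans hη'.symm
  obtain rfl := actΩ_injective this
  rfl

variable (S) in
/-- The submodule of functions with finite supports in the range fibres. -/
def fiberFinite : Submodule ℂ (GP S → ℂ) where
  carrier := {f | FiberFinite f}
  zero_mem' x := by simp
  add_mem' {f₁ f₂} h₁ h₂ x := by
    refine ((h₁ x).union (h₂ x)).subset ?_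
    rintro η ⟨hη, hne⟩
    by_cases h : f₁ η = 0
    · refine Or.inr ⟨hη, fun h' => hne ?_⟩
      rw [Pi.add_apply, h, h', add_zero]
    · exact Or.inl ⟨hη, h⟩
  smul_mem' c f h x := by
    refine (h x).subset ?_
    rintro η ⟨hη, hne⟩
    exact ⟨hη, fun h' => hne (by rw [Pi.smul_apply, h', smul_zero])⟩

theorem FiberFinite.hasFiniteSupport {f₁ : GP S → ℂ} (h₁ : FiberFinite f₁) (f₂ : GP S → ℂ)
    (γ : GP S) : (Function.support fun η : {η : GP S // rng η = rng γ} =>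
      f₁ η.1 * f₂ (mul (inv η.1) γ ((src_inv η.1).trans η.2))).Finite := by
  refine Set.Finite.subset (Set.Finite.preimage Subtype.val_injective.injOn (h₁ (rng γ))) ?_
  rintro η hη
  exact ⟨η.2, left_ne_zero_of_mul hη⟩

theorem conv_add_left {f₁ f₁' : GP S → ℂ} (h : FiberFinite f₁) (h' : FiberFinite f₁')
    (f₂ : GP S → ℂ) : conv (f₁ + f₁') f₂ = conv f₁ f₂ + conv f₁' f₂ := by
  funext γ
  simp only [conv, Pi.add_apply, add_mul]
  exact finsum_add_distrib (h.hasFiniteSupport f₂ γ) (h'.hasFiniteSupport f₂ γ)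

theorem conv_add_right {f₁ : GP S → ℂ} (h : FiberFinite f₁) (f₂ f₂' : GP S → ℂ) :
    conv f₁ (f₂ + f₂') = conv f₁ f₂ + conv f₁ f₂' := by
  funext γ
  simp only [conv, Pi.add_apply, mul_add]
  exact finsum_add_distrib (h.hasFiniteSupport f₂ γ) (h.hasFiniteSupport f₂' γ)

theorem conv_smul_left (c : ℂ) (f₁ f₂ : GP S → ℂ) : conv (c • f₁) f₂ = c • conv f₁ f₂ := by
  funext γ
  simp only [conv, Pi.smul_apply, smul_eq_mul, mul_assoc]
  exact (smul_finsum c _).symm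

theorem conv_smul_right (c : ℂ) (f₁ f₂ : GP S → ℂ) : conv f₁ (c • f₂) = c • conv f₁ f₂ := by
  funext γ
  simp only [conv, Pi.smul_apply, smul_eq_mul, mul_left_comm _ c]
  exact (smul_finsum c _).symm

theorem conv_zero_left (f : GP S → ℂ) : conv 0 f = 0 := by
  have := conv_smul_left 0 (0 : GP S → ℂ) f
  simpa using this

theorem conv_zero_right (f : GP S → ℂ) : conv f 0 = 0 := by
  have := conv_smul_right 0 f (0 : GP S → ℂ)
  simpa using this

variable (S) in
/-- The functions `delta g φ`. -/
def deltas : Set (GP S → ℂ) := {f | ∃ g φ, f = delta g φ}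

theorem fiberFinite_of_mem {f : GP S → ℂ} (h : f ∈ Submodule.span ℂ (deltas S)) :
    FiberFinite f := by
  have : Submodule.span ℂ (deltas S) ≤ fiberFinite S := by
    rw [Submodule.span_le]
    rintro _ ⟨g, φ, rfl⟩
    exact fiberFinite_delta g φ
  exact this h

theorem conv_mem {f₁ f₂ : GP S → ℂ} (h₁ : f₁ ∈ Submodule.span ℂ (deltas S))
    (h₂ : f₂ ∈ Submodule.span ℂ (deltas S)) : conv f₁ f₂ ∈ Submodule.span ℂ (deltas S) := by
  induction h₁ using Submodule.span_induction with
  | mem f hf =>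
    obtain ⟨g, φ, rfl⟩ := hf
    induction h₂ using Submodule.span_induction with
    | mem f hf =>
      obtain ⟨h, ψ, rfl⟩ := hf
      rw [conv_delta]
      exact Submodule.subset_span ⟨_, _, rfl⟩
    | zero => rw [conv_zero_right]; exact Submodule.zero_mem _
    | add f f' _ _ h h' =>
      rw [conv_add_right (fiberFinite_delta g φ)]; exact Submodule.add_mem _ h h'
    | smul c f _ h => rw [conv_smul_right]; exact Submodule.smul_mem _ c h
  | zero => rw [conv_zero_left]; exact Submodule.zero_mem _
  | add f f' hf hf' h h' =>
    rw [conv_add_left (fiberFinite_of_mem hf) (fiberFinite_of_mem hf')]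
    exact Submodule.add_mem _ h h'
  | smul c f _ h => rw [conv_smul_left]; exact Submodule.smul_mem _ c h

theorem invol_add (f f' : GP S → ℂ) : invol (f + f') = invol f + invol f' := by
  funext γ; simp [invol]

theorem invol_smul (c : ℂ) (f : GP S → ℂ) : invol (c • f) = star c • invol f := by
  funext γ; simp [invol]

theorem invol_zero : invol (0 : GP S → ℂ) = 0 := by
  funext γ; simp [invol]

theorem invol_invol (f : GP S → ℂ) : invol (invol f) = f := by
  funext γ; simp [invol, inv_inv]

theorem invol_mem {f : GP S → ℂ} (h : f ∈ Submodule.span ℂ (deltas S)) :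
    invol f ∈ Submodule.span ℂ (deltas S) := by
  induction h using Submodule.span_induction with
  | mem f hf =>
    obtain ⟨g, φ, rfl⟩ := hf
    rw [invol_delta]
    exact Submodule.subset_span ⟨_, _, rfl⟩
  | zero => rw [invol_zero]; exact Submodule.zero_mem _
  | add f f' _ _ h h' => rw [invol_add]; exact Submodule.add_mem _ h h'
  | smul c f _ h => rw [invol_smul]; exact Submodule.smul_mem _ _ h

theorem conv_assoc {f₁ f₂ f₃ : GP S → ℂ} (h₁ : f₁ ∈ Submodule.span ℂ (deltas S))
    (h₂ : f₂ ∈ Submodule.span ℂ (deltas S)) (h₃ : f₃ ∈ Submodule.span ℂ (deltas S)) :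
    conv (conv f₁ f₂) f₃ = conv f₁ (conv f₂ f₃) := by
  induction h₁ using Submodule.span_induction with
  | mem f hf =>
    obtain ⟨g, φ, rfl⟩ := hf
    have hg := fiberFinite_delta g φ
    have hg' : delta g φ ∈ Submodule.span ℂ (deltas S) := Submodule.subset_span ⟨_, _, rfl⟩
    induction h₂ using Submodule.span_induction with
    | mem f hf =>
      obtain ⟨h, ψ, rfl⟩ := hf
      have hh := fiberFinite_delta h ψ
      have hgh : FiberFinite (conv (delta g φ) (delta h ψ)) := by
        rw [conv_delta]; exact fiberFinite_delta _ _
      induction h₃ using Submodule.span_induction with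
      | mem f hf =>
        obtain ⟨k, ω, rfl⟩ := hf
        rw [conv_delta, conv_delta, conv_delta, conv_delta, pull_mul, pull_pull, mul_assoc,
          mul_assoc]
      | zero => simp only [conv_zero_right]
      | add f f' _ _ h h' =>
        rw [conv_add_right hgh, conv_add_right hh, conv_add_right hg, h, h']
      | smul c f _ h => rw [conv_smul_right, conv_smul_right, conv_smul_right, h]
    | zero => simp only [conv_zero_right, conv_zero_left]
    | add f f' hf hf' h h' =>
      rw [conv_add_right hg, conv_add_left (fiberFinite_of_mem hf) (fiberFinite_of_mem hf'),
        conv_add_right hg, conv_add_left (fiberFinite_of_mem (conv_mem hg' hf))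
        (fiberFinite_of_mem (conv_mem hg' hf')), h, h']
    | smul c f _ h =>
      rw [conv_smul_right, conv_smul_left, conv_smul_left, conv_smul_right, h]
  | zero => simp only [conv_zero_left]
  | add f f' hf hf' h h' =>
    rw [conv_add_left (fiberFinite_of_mem hf) (fiberFinite_of_mem hf'),
      conv_add_left (fiberFinite_of_mem (conv_mem hf h₂)) (fiberFinite_of_mem (conv_mem hf' h₂)),
      conv_add_left (fiberFinite_of_mem hf) (fiberFinite_of_mem hf'), h, h']
  | smul c f _ h => rw [conv_smul_left, conv_smul_left, conv_smul_left, h]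

theorem invol_conv {f₁ f₂ : GP S → ℂ} (h₁ : f₁ ∈ Submodule.span ℂ (deltas S))
    (h₂ : f₂ ∈ Submodule.span ℂ (deltas S)) :
    invol (conv f₁ f₂) = conv (invol f₂) (invol f₁) := by
  induction h₁ using Submodule.span_induction with
  | mem f hf =>
    obtain ⟨g, φ, rfl⟩ := hf
    induction h₂ using Submodule.span_induction with
    | mem f hf =>
      obtain ⟨h, ψ, rfl⟩ := hf
      rw [conv_delta, invol_delta, invol_delta, invol_delta, conv_delta, mul_inv']
      congr 1
      rw [star_mul, pull_mul, pull_pull, ← pull_star, pull_pull]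
      ext χ
      rw [ContinuousMap.mul_apply, ContinuousMap.mul_apply]
      by_cases H : χ.1.1 (dom (h⁻¹ * g⁻¹)) = true
      · congr 1
        obtain ⟨hg, hh⟩ := (dom_mul_iff _ _ _).1 H
        rw [← mul_assoc, ← pull_pull, pull_pos _ hg, pull_pos _ hg]
        exact pull_idem (dom h⁻¹) _ hh
      · rw [pull_neg _ H, zero_mul, zero_mul]
    | zero => simp only [conv_zero_right, invol_zero, conv_zero_left]
    | add f f' hf hf' h h' =>
      rw [conv_add_right (fiberFinite_delta g φ), invol_add, invol_add, conv_add_left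
        (fiberFinite_of_mem (invol_mem hf)) (fiberFinite_of_mem (invol_mem hf')), h, h']
    | smul c f _ h => rw [conv_smul_right, invol_smul, invol_smul, conv_smul_left, h]
  | zero => simp only [conv_zero_left, invol_zero, conv_zero_right]
  | add f f' hf hf' h h' =>
    rw [conv_add_left (fiberFinite_of_mem hf) (fiberFinite_of_mem hf'), invol_add, invol_add,
      conv_add_right (fiberFinite_of_mem (invol_mem h₂)), h, h']
  | smul c f _ h => rw [conv_smul_left, invol_smul, invol_smul, conv_smul_right, h]

/-! The space `C_c(𝒢_P(S))` is spanned by the functions `delta g φ`. -/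

theorem isOpen_germ_preimage {W : Set (GP S)} (hW : IsOpen W) (g : LeftHull S) :
    IsOpen {χ : omega S | ∃ h, germ g χ h ∈ W} := by
  obtain ⟨W', hW', rfl⟩ := isOpen_induced_iff.1 hW
  exact (Paterson.isOpen_germ_preimage hW' g).preimage continuous_subtype_val

/-- `D(g, U)` for `U ⊆ Ω(S)`. -/
def germSet (g : LeftHull S) (U : Set (omega S)) : Set (GP S) :=
  {γ | ∃ χ h, χ ∈ U ∧ γ = germ g χ h}

theorem isOpen_germSet (g : LeftHull S) {U : Set (omega S)} (hU : IsOpen U) :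
    IsOpen (germSet g U) := by
  obtain ⟨O, hO, rfl⟩ := isOpen_induced_iff.1 hU
  refine isOpen_induced_iff.2 ⟨basicSet g (O ∩ {χ : semiChars S | χ.1 (dom g) = true}),
    TopologicalSpace.isOpen_generateFrom_of_mem ⟨g, _, hO.inter (isClopen_eval _).isOpen,
      Set.inter_subset_right, rfl⟩, ?_⟩
  ext γ
  constructor
  · rintro ⟨χ, h, hχ, e⟩
    have hmem : χ ∈ omega S := by have := γ.2; rw [e] at this; exact this
    exact ⟨⟨χ, hmem⟩, h, hχ.1, Subtype.ext e⟩
  · rintro ⟨χ, h, hχ, rfl⟩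
    exact ⟨χ.1, h, ⟨hχ, h⟩, rfl⟩

theorem continuous_src : Continuous (src : GP S → omega S) := by
  refine ⟨fun U hU => ?_⟩
  have : src ⁻¹' U = ⋃ g, germSet (S := S) g U := by
    ext γ
    simp only [Set.mem_preimage, Set.mem_iUnion]
    constructor
    · intro h
      obtain ⟨g, χ, hg, rfl⟩ := exists_germ γ
      exact ⟨g, χ, hg, h, rfl⟩
    · rintro ⟨g, χ, hg, h, rfl⟩
      exact h
  rw [this]
  exact isOpen_iUnion fun g => isOpen_germSet g hU

theorem continuous_germ (g : LeftHull S) :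
    Continuous fun χ : {χ : omega S | χ.1.1 (dom g) = true} => germ g χ.1 χ.2 := by
  refine ⟨fun W hW => ?_⟩
  refine isOpen_induced_iff.2 ⟨_, isOpen_germ_preimage hW g, ?_⟩
  ext χ
  exact ⟨fun ⟨_, h⟩ => h, fun h => ⟨χ.2, h⟩⟩

instance : CompactSpace (semiChars S) := isCompact_iff_compactSpace.1 semiChars.isClosed.isCompact

instance : CompactSpace (omega S) :=
  isCompact_iff_compactSpace.1 (isClosed_closure (s := Set.range point)).isCompact

theorem isCompact_germSet (g : LeftHull S) {U : Set (omega S)} (hU : IsClosed U) :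
    IsCompact (germSet g U) := by
  have hc : IsCompact {χ : {χ : omega S | χ.1.1 (dom g) = true} | χ.1 ∈ U} := by
    have : CompactSpace {χ : omega S | χ.1.1 (dom g) = true} :=
      isCompact_iff_compactSpace.1 (isClopen_domΩ (dom g)).isClosed.isCompact
    exact (hU.preimage continuous_subtype_val).isCompact
  convert hc.image (continuous_germ g)
  ext γ
  constructor
  · rintro ⟨χ, h, hχ, rfl⟩
    exact ⟨⟨χ, h⟩, hχ, rfl⟩
  · rintro ⟨χ, hχ, rfl⟩
    exact ⟨χ.1, χ.2, hχ, rfl⟩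

theorem bisection_eq (g : LeftHull S) : bisection g = germSet g (Set.univ : Set (omega S)) := by
  ext γ
  exact ⟨fun ⟨χ, h, e⟩ => ⟨χ, h, trivial, e⟩, fun ⟨χ, h, _, e⟩ => ⟨χ, h, e⟩⟩

theorem delta_mem_Cc (g : LeftHull S) (φ : C(omega S, ℂ)) : delta g φ ∈ Cc (GP S) := by
  refine Submodule.subset_span ⟨bisection g, ?_, ?_, ?_, bisection g, subset_rfl, ?_, ?_⟩
  · rw [bisection_eq]; exact isOpen_germSet g isOpen_univ
  · refine T2Space.of_injective_continuous (f := fun γ : bisection g => src γ.1) ?_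
      (continuous_src.comp continuous_subtype_val)
    rintro ⟨γ, χ, h, rfl⟩ ⟨γ', χ', h', rfl⟩ (e : χ = χ')
    subst e
    rfl
  · refine (φ.continuous.comp continuous_src).continuousOn.congr fun γ hγ => ?_
    exact if_pos hγ
  · rw [bisection_eq]; exact isCompact_germSet g isClosed_univ
  · intro γ hγ
    exact delta_of_notMem φ hγ

theorem mem_span_of_cover {V : Set (GP S)} (hVT : T2Space V)
    (t : Finset (LeftHull S × TopologicalSpace.Clopens (omega S)))
    (ht : ∀ x ∈ t, germSet x.1 (x.2 : Set (omega S)) ⊆ V) :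
    ∀ f : GP S → ℂ, ContinuousOn f V →
      (∀ γ, (∀ x ∈ t, γ ∉ germSet x.1 (x.2 : Set (omega S))) → f γ = 0) →
      f ∈ Submodule.span ℂ (deltas S) := by
  classical
  induction t using Finset.induction_on with
  | empty =>
    intro f _ hf
    have : f = 0 := funext fun γ => hf γ (by simp)
    rw [this]
    exact Submodule.zero_mem _
  | insert x t hx ih =>
    intro f hfV hf
    obtain ⟨g, A⟩ := x
    set B : Set (GP S) := germSet g (A : Set (omega S)) with hB
    have hBV : B ⊆ V := ht _ (Finset.mem_insert_self _ _)
    have hBo : IsOpen B := isOpen_germSet g A.isClopen.isOpen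
    have hBc : IsClosed ((Subtype.val : V → GP S) ⁻¹' B) := by
      refine IsCompact.isClosed ?_
      rw [Subtype.isCompact_iff, Subtype.image_preimage_coe, Set.inter_eq_right.2 hBV]
      exact isCompact_germSet g A.isClopen.isClosed
    have hBcl : IsClopen ((Subtype.val : V → GP S) ⁻¹' B) :=
      ⟨hBc, hBo.preimage continuous_subtype_val⟩
    have hsplit : f = B.indicator f + Bᶜ.indicator f := (Set.indicator_self_add_compl B f).symm
    rw [hsplit]
    refine Submodule.add_mem _ ?_ ?_
    · have hP : IsClopen {χ : omega S | χ ∈ (A : Set (omega S)) ∧ χ.1.1 (dom g) = true} :=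
        A.isClopen.inter (isClopen_domΩ (dom g))
      let φ : C(omega S, ℂ) :=
        ⟨fun χ => if h : χ ∈ (A : Set (omega S)) ∧ χ.1.1 (dom g) = true
          then f (germ g χ h.2) else 0, by
          convert! continuous_extend hP (fun χ h => f (germ g χ h.2)) ?_
          have h1 : Continuous fun χ :
              {χ : omega S | χ ∈ (A : Set (omega S)) ∧ χ.1.1 (dom g) = true} =>
              germ g χ.1 χ.2.2 :=
            (continuous_germ g).comp (continuous_subtype_val.subtype_mk fun χ => χ.2.2)
          exact hfV.comp_continuous h1 fun χ => hBV ⟨χ.1, χ.2.2, χ.2.1, rfl⟩⟩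
      have : B.indicator f = delta g φ := by
        funext γ
        by_cases hγ : γ ∈ bisection g
        · obtain ⟨χ, h, rfl⟩ := hγ
          rw [delta_germ]
          by_cases hA : χ ∈ (A : Set (omega S))
          · rw [Set.indicator_of_mem (show germ g χ h ∈ B from ⟨χ, h, hA, rfl⟩)]
            have hc : χ ∈ (A : Set (omega S)) ∧ χ.1.1 (dom g) = true := ⟨hA, h⟩
            change _ = dite _ _ _
            rw [dif_pos hc]
          · rw [Set.indicator_of_notMem]
            · have hc : ¬ (χ ∈ (A : Set (omega S)) ∧ χ.1.1 (dom g) = true) := fun h' => hA h'.1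
              change _ = dite _ _ _
              rw [dif_neg hc]
            · rintro ⟨χ', h', hA', e⟩
              obtain ⟨rfl, -⟩ := germ_eq_iff.1 e
              exact hA hA'
        · rw [delta_of_notMem _ hγ, Set.indicator_of_notMem]
          rintro ⟨χ, h, -, e⟩
          exact hγ ⟨χ, h, e⟩
      rw [this]
      exact Submodule.subset_span ⟨g, φ, rfl⟩
    · refine ih (fun y hy => ht y (Finset.mem_insert_of_mem hy)) _ ?_ ?_
      · rw [continuousOn_iff_continuous_domRestrict] at hfV ⊢
        have := hfV.indicator (s := ((Subtype.val : V → GP S) ⁻¹' Bᶜ)) (by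
          intro a ha
          have : IsClopen ((Subtype.val : V → GP S) ⁻¹' Bᶜ) := hBcl.compl
          rw [this.frontier_eq] at ha
          exact absurd ha (Set.notMem_empty a))
        exact this
      · intro γ hγ
        by_cases h : γ ∈ B
        · exact Set.indicator_of_notMem (s := Bᶜ) (fun h' => h' h) _
        · rw [Set.indicator_of_mem (show γ ∈ Bᶜ from h)]
          refine hf γ fun y hy => ?_
          rcases Finset.mem_insert.1 hy with rfl | hy
          · exact h
          · exact hγ y hy

theorem Cc_eq_span : Cc (GP S) = Submodule.span ℂ (deltas S) := by
  apply le_antisymm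
  · refine Submodule.span_le.2 ?_
    rintro f ⟨V, hV, hVT, hfV, K, hKV, hK, hf⟩
    let ι := {x : LeftHull S × TopologicalSpace.Clopens (omega S) //
      germSet x.1 (x.2 : Set (omega S)) ⊆ V}
    obtain ⟨t, ht⟩ := hK.elim_finite_subcover
      (fun x : ι => germSet x.1.1 (x.1.2 : Set (omega S)))
      (fun x => isOpen_germSet _ x.1.2.isClopen.isOpen) (by
        intro γ hγ
        obtain ⟨g, χ, h, rfl⟩ := exists_germ γ
        have ho := (isOpen_germ_preimage hV g)
        obtain ⟨A, hA, hχA, hAV⟩ := compact_exists_isClopen_in_isOpen ho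
          (show χ ∈ {χ : omega S | ∃ h, germ g χ h ∈ V} from ⟨h, hKV hγ⟩)
        refine Set.mem_iUnion.2 ⟨⟨(g, ⟨A, hA⟩), ?_⟩, χ, h, hχA, rfl⟩
        rintro _ ⟨χ', h', hχ', rfl⟩
        obtain ⟨_, h''⟩ := hAV hχ'
        exact h'')
    classical
    refine mem_span_of_cover hVT (t.image Subtype.val) ?_ f hfV ?_
    · intro x hx
      obtain ⟨y, -, rfl⟩ := Finset.mem_image.1 hx
      exact y.2
    · intro γ hγ
      refine hf γ fun hγK => ?_
      obtain ⟨x, hx, hγx⟩ := Set.mem_iUnion₂.1 (ht hγK)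
      exact hγ x.1 (Finset.mem_image_of_mem _ hx) hγx
  · refine Submodule.span_le.2 ?_
    rintro _ ⟨g, φ, rfl⟩
    exact delta_mem_Cc g φ

end GP

/-! ### The *-algebra `C_c(𝒢_P(S))` and its C*-enveloping algebra -/

open GP

variable (S) in
/-- The *-algebra `C_c(𝒢_P(S))` with convolution and the involution `f*(γ) = conj f(γ⁻¹)`. -/
def CcAlg : Type u := Cc (GP S)

namespace CcAlg

noncomputable instance : AddCommGroup (CcAlg S) := inferInstanceAs (AddCommGroup (Cc (GP S)))

noncomputable instance : Module ℂ (CcAlg S) := inferInstanceAs (Module ℂ (Cc (GP S)))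

theorem mem_span (f : CcAlg S) : f.1 ∈ Submodule.span ℂ (deltas S) := Cc_eq_span (S := S) ▸ f.2

theorem fiberFinite (f : CcAlg S) : FiberFinite f.1 := fiberFinite_of_mem f.mem_span

/-- The function `delta g φ` as an element of the *-algebra. -/
noncomputable def d (g : LeftHull S) (φ : C(omega S, ℂ)) : CcAlg S := ⟨delta g φ, delta_mem_Cc g φ⟩

noncomputable instance : Mul (CcAlg S) where
  mul f₁ f₂ := ⟨conv f₁.1 f₂.1, Cc_eq_span.ge (conv_mem f₁.mem_span f₂.mem_span)⟩

/-- The unit is the indicator function of the unit space `D(e, Ω(S))`. -/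
noncomputable instance : One (CcAlg S) := ⟨d 1 1⟩

noncomputable instance : Star (CcAlg S) where
  star f := ⟨invol f.1, Cc_eq_span.ge (invol_mem f.mem_span)⟩

theorem d_mul (g h : LeftHull S) (φ ψ : C(omega S, ℂ)) :
    d g φ * d h ψ = d (g * h) (pull h φ * ψ) := Subtype.ext (conv_delta g h φ ψ)

theorem d_congr {g : LeftHull S} {φ ψ : C(omega S, ℂ)}
    (H : ∀ χ : omega S, χ.1.1 (dom g) = true → φ χ = ψ χ) : d g φ = d g ψ :=
  Subtype.ext (delta_congr H)

theorem d_star (g : LeftHull S) (φ : C(omega S, ℂ)) : star (d g φ) = d g⁻¹ (pull g⁻¹ (star φ)) :=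
  Subtype.ext (invol_delta g φ)

@[elab_as_elim]
theorem induction {P : CcAlg S → Prop} (f : CcAlg S) (hd : ∀ g φ, P (d g φ)) (h0 : P 0)
    (hadd : ∀ f f', P f → P f' → P (f + f')) (hsmul : ∀ (c : ℂ) f, P f → P (c • f)) : P f := by
  have key : ∀ f (hf : f ∈ Submodule.span ℂ (deltas S)),
      P ⟨f, (Cc_eq_span (S := S)).symm ▸ hf⟩ := by
    intro f hf
    induction hf using Submodule.span_induction with
    | mem f hf => obtain ⟨g, φ, rfl⟩ := hf; exact hd g φ
    | zero => exact h0
    | add f f' _ _ h h' => exact hadd _ _ h h'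
    | smul c f _ h => exact hsmul c _ h
  exact key f.1 f.mem_span

theorem mul_smul' (c : ℂ) (f f' : CcAlg S) : f * (c • f') = c • (f * f') :=
  Subtype.ext (conv_smul_right c f.1 f'.1)

theorem smul_mul' (c : ℂ) (f f' : CcAlg S) : (c • f) * f' = c • (f * f') :=
  Subtype.ext (conv_smul_left c f.1 f'.1)

theorem mul_add' (f f' f'' : CcAlg S) : f * (f' + f'') = f * f' + f * f'' :=
  Subtype.ext (conv_add_right f.fiberFinite f'.1 f''.1)

theorem add_mul' (f f' f'' : CcAlg S) : (f + f') * f'' = f * f'' + f' * f'' :=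
  Subtype.ext (conv_add_left f.fiberFinite f'.fiberFinite f''.1)

theorem zero_mul' (f : CcAlg S) : 0 * f = 0 := Subtype.ext (conv_zero_left f.1)

theorem mul_zero' (f : CcAlg S) : f * 0 = 0 := Subtype.ext (conv_zero_right f.1)

theorem pull_one (φ : C(omega S, ℂ)) : pull 1 φ = φ := by
  ext χ
  exact pull_idem 1 φ (semiChars.map_one χ.1)

theorem one_mul' (f : CcAlg S) : 1 * f = f := by
  induction f using CcAlg.induction with
  | hd g φ =>
    refine (d_mul 1 g 1 φ).trans ?_
    rw [one_mul]
    refine d_congr fun χ h => ?_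
    rw [ContinuousMap.mul_apply, pull_pos _ h, ContinuousMap.one_apply, one_mul]
  | h0 => exact mul_zero' 1
  | hadd f f' h h' => rw [mul_add', h, h']
  | hsmul c f h => rw [mul_smul', h]

theorem mul_one' (f : CcAlg S) : f * 1 = f := by
  induction f using CcAlg.induction with
  | hd g φ =>
    refine (d_mul g 1 φ 1).trans ?_
    rw [mul_one, mul_one, pull_one]
  | h0 => exact zero_mul' 1
  | hadd f f' h h' => rw [add_mul', h, h']
  | hsmul c f h => rw [smul_mul', h]

noncomputable instance : Ring (CcAlg S) :=
  { (inferInstance : AddCommGroup (CcAlg S)) with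
    mul := (· * ·)
    one := 1
    left_distrib := mul_add'
    right_distrib := add_mul'
    zero_mul := zero_mul'
    mul_zero := mul_zero'
    one_mul := one_mul'
    mul_one := mul_one'
    mul_assoc := fun f f' f'' =>
      Subtype.ext (conv_assoc f.mem_span f'.mem_span f''.mem_span) }

noncomputable instance : Algebra ℂ (CcAlg S) := Algebra.ofModule smul_mul' mul_smul'

noncomputable instance : StarRing (CcAlg S) where
  star_involutive f := Subtype.ext (invol_invol f.1)
  star_mul f f' := Subtype.ext (invol_conv f.mem_span f'.mem_span)
  star_add f f' := Subtype.ext (invol_add f.1 f'.1)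

instance : StarModule ℂ (CcAlg S) where
  star_smul c f := Subtype.ext (invol_smul c f.1)

theorem d_add (g : LeftHull S) (φ ψ : C(omega S, ℂ)) : d g (φ + ψ) = d g φ + d g ψ := by
  apply Subtype.ext
  funext γ
  change delta g (φ + ψ) γ = delta g φ γ + delta g ψ γ
  by_cases h : γ ∈ bisection g <;> simp [delta, h]

theorem d_smul (g : LeftHull S) (c : ℂ) (φ : C(omega S, ℂ)) : d g (c • φ) = c • d g φ := by
  apply Subtype.ext
  funext γ
  change delta g (c • φ) γ = c • delta g φ γ
  by_cases h : γ ∈ bisection g <;> simp [delta, h]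

theorem d_one_mul (φ ψ : C(omega S, ℂ)) : d 1 (φ * ψ) = d 1 φ * d 1 ψ := by
  rw [d_mul, pull_one, mul_one]

theorem d_one_star (φ : C(omega S, ℂ)) : d 1 (star φ) = star (d 1 φ) := by
  rw [d_star]
  change _ = d 1 (pull 1 (star φ))
  rw [pull_one]

/-- The restriction of a C*-seminorm to the functions on the unit space. -/
noncomputable def restrictUnits (p : CStarSeminorm (CcAlg S)) : CStarSeminorm C(omega S, ℂ) where
  toFun φ := p (d 1 φ)
  map_zero' := by
    have : d (S := S) 1 0 = 0 := by simpa using d_smul (S := S) 1 0 0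
    rw [this, map_zero]
  add_le' φ ψ := by rw [d_add]; exact map_add_le_add _ _ _
  neg' φ := by
    have : d (S := S) 1 (-φ) = - d 1 φ := by simpa using d_smul (S := S) 1 (-1) φ
    rw [this, map_neg_eq_map]
  smul' c φ := by rw [d_smul]; exact map_smul_eq_mul _ _ _
  mul_le' φ ψ := by
    change p (d 1 (φ * ψ)) ≤ p (d 1 φ) * p (d 1 ψ)
    rw [d_one_mul]
    exact p.mul_le _ _
  star_mul_self' φ := by
    change p (d 1 (star φ * φ)) = p (d 1 φ) * p (d 1 φ)
    rw [d_one_mul, d_one_star]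
    exact p.star_mul_self _

theorem star_d_mul_d (g : LeftHull S) (φ : C(omega S, ℂ)) :
    star (d g φ) * d g φ = d 1 (pull g 1 * (star φ * φ)) := by
  rw [d_star, d_mul, pull_pull]
  apply Subtype.ext
  funext γ
  change delta (dom g).1 (pull (dom g).1 (star φ) * φ) γ = delta 1 (pull g 1 * (star φ * φ)) γ
  by_cases hγ : γ ∈ bisection (dom g).1
  · obtain ⟨χ, h, rfl⟩ := hγ
    have h' : χ.1.1 (dom g) = true := by rwa [dom_idem] at h
    have e : GP.germ (dom g).1 χ h = GP.germ 1 χ (by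
        have : dom (1 : LeftHull S) = 1 := dom_idem 1
        rw [this]; exact semiChars.map_one _) :=
      germ_eq_iff.2 ⟨rfl, dom g, by rw [(dom g).2.eq, one_mul], h'⟩
    rw [delta_germ, e, delta_germ]
    simp only [ContinuousMap.mul_apply]
    rw [pull_idem _ _ h', pull_pos _ h', ContinuousMap.one_apply, one_mul]
  · rw [delta_of_notMem _ hγ]
    by_cases h1 : γ ∈ bisection 1
    · obtain ⟨χ, h, rfl⟩ := h1
      rw [delta_germ, ContinuousMap.mul_apply, pull_neg, zero_mul]
      intro h'
      apply hγ
      exact ⟨χ, by rwa [dom_idem],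
        germ_eq_iff.2 ⟨rfl, dom g, by rw [(dom g).2.eq, one_mul], h'⟩⟩
    · rw [delta_of_notMem _ h1]

instance : HasCStarEnvelope (CcAlg S) where
  bddAbove f := by
    suffices h : ∃ C, ∀ p : CStarSeminorm (CcAlg S), p f ≤ C by
      obtain ⟨C, hC⟩ := h
      exact ⟨C, by rintro _ ⟨p, rfl⟩; exact hC p⟩
    induction f using CcAlg.induction with
    | hd g φ =>
      refine ⟨√‖pull g 1 * (star φ * φ)‖, fun p => Real.le_sqrt_of_sq_le ?_⟩
      rw [sq, ← p.star_mul_self, star_d_mul_d]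
      exact (restrictUnits p).le_norm _
    | h0 => exact ⟨0, fun p => (map_zero p.toSeminorm).le⟩
    | hadd f f' h h' =>
      obtain ⟨C, hC⟩ := h
      obtain ⟨C', hC'⟩ := h'
      exact ⟨C + C', fun p => (map_add_le_add p.toSeminorm f f').trans (add_le_add (hC p) (hC' p))⟩
    | hsmul c f h =>
      obtain ⟨C, hC⟩ := h
      refine ⟨‖c‖ * C, fun p => ?_⟩
      rw [map_smul_eq_mul]
      exact mul_le_mul_of_nonneg_left (hC p) (norm_nonneg c)

end CcAlg

variable (S) in
/-- The full groupoid C*-algebra `C*(𝒢_P(S))`: the C*-enveloping algebra of `C_c(𝒢_P(S))`. -/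
abbrev FullGPAlgebra : Type u := CStarEnvelope (CcAlg S)

/-- The indicator function of `D(s, Ω(S))` belongs to `C_c(𝒢_P(S))`. -/
theorem indicator_bisection_mem (s : S) :
    (bisection (LeftHull.tr s)).indicator (fun _ => (1 : ℂ)) ∈ Cc (GP S) := by
  have : (bisection (LeftHull.tr s)).indicator (fun _ => (1 : ℂ)) = delta (LeftHull.tr s) 1 := by
    funext γ
    by_cases h : γ ∈ bisection (LeftHull.tr s) <;> simp [delta, h]
  rw [this]
  exact delta_mem_Cc (LeftHull.tr s) 1

/-- The element `v_s = 𝟙_{D(s, Ω(S))}` of `C*(𝒢_P(S))`. -/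
noncomputable def gpGenerator (s : S) : FullGPAlgebra S :=
  CStarEnvelope.of (CcAlg S)
    ⟨(bisection (LeftHull.tr s)).indicator (fun _ => (1 : ℂ)), indicator_bisection_mem s⟩

end Groupoid

/-! ### The relations -/

section Relations

universe u w

variable {S : Type u} [LeftCancelMonoid S]

/-- The element `s₁⁻¹ t₁ ⋯ sₙ⁻¹ tₙ` of the left inverse hull given by a list of pairs
`(s₁, t₁), …, (sₙ, tₙ)`. The empty list presents the identity `e⁻¹ e`. -/
noncomputable def hullWord (l : List (S × S)) : LeftHull S :=
  (l.map fun x => (LeftHull.tr x.1)⁻¹ * LeftHull.tr x.2).prod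

theorem hullWord_inv (l : List (S × S)) :
    (hullWord l)⁻¹ = hullWord (l.reverse.map Prod.swap) := by
  induction l with
  | nil => exact Subtype.ext PEquiv.symm_refl
  | cons x l ih =>
    have h1 : hullWord (x :: l) = (LeftHull.tr x.1)⁻¹ * LeftHull.tr x.2 * hullWord l := by
      simp [hullWord]
    rw [h1, LeftHull.mul_inv', LeftHull.mul_inv', LeftHull.inv_inv', ih]
    simp [hullWord]

theorem exists_hullWord (g : LeftHull S) : ∃ l : List (S × S), hullWord l = g := by
  obtain ⟨f, hf⟩ := g
  induction hf with
  | translation s =>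
    refine ⟨[(1, s)], ?_⟩
    have : (LeftHull.tr (1 : S))⁻¹ = 1 := by
      ext x y
      rw [LeftHull.mem_inv, LeftHull.mem_one]
      change x ∈ leftTranslation 1 y ↔ _
      rw [mem_leftTranslation, one_mul, eq_comm]
    simp only [hullWord, List.map_cons, List.map_nil, List.prod_cons, List.prod_nil, mul_one,
      this, one_mul]
    rfl
  | symm hf ih =>
    obtain ⟨l, hl⟩ := ih
    exact ⟨_, (hullWord_inv l).symm.trans (by rw [hl]; rfl)⟩
  | trans hf hg ihf ihg =>
    obtain ⟨l, hl⟩ := ihf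
    obtain ⟨l', hl'⟩ := ihg
    refine ⟨l' ++ l, ?_⟩
    have : hullWord (l' ++ l) = hullWord l' * hullWord l := by simp [hullWord]
    rw [this, hl, hl']
    rfl

/-- A subset of `S` is a constructible right ideal if it has the form `s₁⁻¹ t₁ ⋯ sₙ⁻¹ tₙ S`, that
is, if it is the image of the partial bijection `s₁⁻¹ t₁ ⋯ sₙ⁻¹ tₙ`. -/
def IsConstructible (X : Set S) : Prop :=
  ∃ l : List (S × S), X = {x | ∃ y, x ∈ (hullWord l).1 y}

open Classical in
/-- The idempotent `p_X`, the identity map of the constructible ideal `X`. -/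
noncomputable def idemOf (X : Set S) (hX : IsConstructible X) : LeftHull S :=
  ⟨PEquiv.ofSet X, by
    obtain ⟨l, hl⟩ := hX
    have : PEquiv.ofSet X = (hullWord l * (hullWord l)⁻¹).1 := by
      refine PEquiv.ext fun x => Option.ext fun y => ?_
      change _ ↔ y ∈ (hullWord l * (hullWord l)⁻¹).1 x
      rw [LeftHull.mem_mul]
      change y ∈ PEquiv.ofSet X x ↔ _
      rw [PEquiv.mem_ofSet_iff]
      constructor
      · rintro ⟨rfl, hx⟩
        rw [hl] at hx
        obtain ⟨z, hz⟩ := hx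
        exact ⟨z, LeftHull.mem_inv.2 hz, hz⟩
      · rintro ⟨z, hz, hy⟩
        have hz' := LeftHull.mem_inv.1 hz
        obtain rfl := LeftHull.val_unique hz' hy
        exact ⟨rfl, by rw [hl]; exact ⟨z, hy⟩⟩
    rw [this]
    exact (hullWord l * (hullWord l)⁻¹).2⟩

variable {B : Type w} [Ring B] [StarRing B]

/-- The product `v_{s₁}* v_{t₁} ⋯ v_{sₙ}* v_{tₙ}`. -/
def algWord (v : S → B) (l : List (S × S)) : B := (l.map fun x => star (v x.1) * v x.2).prod

/-- The element `v_g`: the product `v_{s₁}* v_{t₁} ⋯ v_{sₙ}* v_{tₙ}` for some presentation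
`g = s₁⁻¹ t₁ ⋯ sₙ⁻¹ tₙ`. It is independent of the presentation when the second relation of
`HullRelations` holds. -/
noncomputable def algElem (v : S → B) (g : LeftHull S) : B :=
  algWord v (exists_hullWord g).choose

/-- The relations on a family `v_s`, `s ∈ S`. -/
structure HullRelations (v : S → B) : Prop where
  /-- `v_e = 1`. -/
  one : v 1 = 1
  /-- `v_g` is independent of the presentation of `g`. -/
  well_defined : ∀ l l' : List (S × S), hullWord l = hullWord l' → algWord v l = algWord v l'
  /-- If the map `0` with empty domain is in the left inverse hull, then `v_0 = 0`. -/
  zero : ∀ g : LeftHull S, g.1 = ⊥ → algElem v g = 0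
  /-- If `X = X₁ ∪ ⋯ ∪ Xₙ` for constructible ideals, `n ≥ 1`, then
  `∏ (v_{p_X} - v_{p_{X_i}}) = 0`. -/
  union : ∀ (n : ℕ) (X : Set S) (Y : Fin n → Set S) (hX : IsConstructible X)
    (hY : ∀ i, IsConstructible (Y i)), 0 < n → X = ⋃ i, Y i →
    (List.ofFn fun i => algElem v (idemOf X hX) - algElem v (idemOf (Y i) (hY i))).prod = 0

end Relations

universe u w

/-!
The relations on `(v_s)` say precisely that `g ↦ v_g` is a *-representation of the left inverse
hull which respects finite covers of constructible ideals. The projections `v_p`, `p ∈ E(S)`,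
commute, and a character of the C*-algebra they generate restricts to a semicharacter of `E(S)`.
The points of `Ω(S)` are exactly the semicharacters compatible with finite covers, so the joint
spectrum of the projections maps to `Ω(S)`, and Gelfand duality yields a representation `π` of
`C(Ω(S))`.

Then `𝟙_{D(g, Ω(S))} φ ↦ v_g π(φ)` should define a representation of `C_c(𝒢_P(S))`. It is well
defined although the groupoid need not be Hausdorff: near a fixed `χ ∈ Ω(S)`, elements of the hull
with the same germ at `χ` coincide, so a linear relation can be checked germ by germ, and a
partition of unity on `Ω(S)` patches the local relations together.
-/

section CStarEnvelope

variable {A : Type u} [Ring A] [StarRing A] [Algebra ℂ A] {B : Type w} [CStarAlgebra B]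

/-- The C*-seminorm `a ↦ ‖ρ a‖` of a *-homomorphism `ρ` into a C*-algebra. -/
noncomputable def CStarSeminorm.ofHom (ρ : A →⋆ₐ[ℂ] B) : CStarSeminorm A where
  toFun a := ‖ρ a‖
  map_zero' := by rw [map_zero, norm_zero]
  add_le' a b := by rw [map_add]; exact norm_add_le _ _
  neg' a := by rw [map_neg, norm_neg]
  smul' c a := by rw [map_smul, norm_smul]
  mul_le' a b := by rw [map_mul]; exact norm_mul_le _ _
  star_mul_self' a := by rw [map_mul, map_star]; exact CStarRing.norm_star_mul_self

theorem CStarSeminorm.continuous_of_norm_le (p : CStarSeminorm A) (r : p.Carrier →+* B)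
    (hr : ∀ a, ‖r a‖ ≤ p a) : Continuous r :=
  AddMonoidHomClass.continuous_of_bound r 1 fun a => (hr a).trans_eq (one_mul _).symm

variable [StarModule ℂ A]

/-- The extension by continuity of a *-homomorphism dominated by a C*-seminorm `p` to the
completion with respect to `p`. -/
noncomputable def CStarSeminorm.lift (p : CStarSeminorm A) (ρ : A →⋆ₐ[ℂ] B)
    (hρ : ∀ a, ‖ρ a‖ ≤ p a) : p.Completion →⋆ₐ[ℂ] B :=
  let r : p.Carrier →+* B := (ρ : A →+* B)
  let F : p.Completion →+* B :=
    UniformSpace.Completion.extensionHom r (p.continuous_of_norm_le r hρ)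
  have F_coe (a : A) : F (p.coe a) = ρ a := UniformSpace.Completion.extensionHom_coe r _ a
  have hF : Continuous F := UniformSpace.Completion.continuous_extension
  { F with
    commutes' c := by
      rw [← AlgHomClass.commutes p.toCompletion c, ← AlgHomClass.commutes ρ c]
      exact F_coe _
    map_star' x :=
      p.induction (P := fun x => F (star x) = star (F x)) x
        (isClosed_eq (hF.comp p.continuous_star) hF.star) fun a => by
          rw [← p.coe_star, F_coe, F_coe, map_star] }

theorem CStarSeminorm.lift_toCompletion (p : CStarSeminorm A) (ρ : A →⋆ₐ[ℂ] B)
    (hρ : ∀ a, ‖ρ a‖ ≤ p a) (a : A) : p.lift ρ hρ (p.toCompletion a) = ρ a :=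
  let r : p.Carrier →+* B := (ρ : A →+* B)
  UniformSpace.Completion.extensionHom_coe r (p.continuous_of_norm_le r hρ) a

namespace CStarEnvelope

variable [HasCStarEnvelope A]

/-- The extension of a *-homomorphism into a C*-algebra to the C*-enveloping algebra. -/
noncomputable def lift (ρ : A →⋆ₐ[ℂ] B) : CStarEnvelope A →⋆ₐ[ℂ] B :=
  (maxCStarSeminorm A).lift ρ (CStarSeminorm.ofHom ρ).le_iSup

theorem lift_of (ρ : A →⋆ₐ[ℂ] B) (a : A) : lift ρ (of A a) = ρ a :=
  CStarSeminorm.lift_toCompletion _ _ _ a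

end CStarEnvelope

end CStarEnvelope

section Gelfand

open scoped CStarAlgebra in
theorem starAlgHom_eq_of_eqOn_of_dense {A : Type u} {B : Type w} [CStarAlgebra A] [CStarAlgebra B]
    {s : Set A} (hs : (StarAlgebra.adjoin ℂ s).topologicalClosure = ⊤) {φ ψ : A →⋆ₐ[ℂ] B}
    (h : Set.EqOn φ ψ s) : φ = ψ := by
  have hclosed : IsClosed (StarAlgHom.equalizer φ ψ : Set A) :=
    isClosed_eq (map_continuous φ) (map_continuous ψ)
  have hle : (StarAlgebra.adjoin ℂ s).topologicalClosure ≤ StarAlgHom.equalizer φ ψ :=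
    StarSubalgebra.topologicalClosure_minimal (StarAlgHom.adjoin_le_equalizer φ ψ h) hclosed
  exact StarAlgHom.ext fun a => hle (hs ▸ StarSubalgebra.mem_top)

/-- Commuting self-adjoint elements generate a commutative C*-algebra, to which Gelfand duality
applies. -/
theorem exists_injective_continuousMap_hom {B : Type w} [CStarAlgebra B] {M : Type*} [CommMonoid M]
    (e : M →* B) (hsa : ∀ m, IsSelfAdjoint (e m)) :
    ∃ (K : Type w) (_ : TopologicalSpace K) (_ : CompactSpace K) (J : C(K, ℂ) →⋆ₐ[ℂ] B)
      (f : M →* C(K, ℂ)), Function.Injective J ∧ ∀ m, J (f m) = e m := by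
  have hcomm : ∀ a ∈ Set.range e, ∀ b ∈ Set.range e, a * b = b * a := by
    rintro _ ⟨m, rfl⟩ _ ⟨n, rfl⟩
    rw [← map_mul, mul_comm, map_mul]
  have hcomm_star : ∀ a ∈ Set.range e, ∀ b ∈ Set.range e, a * star b = star b * a := by
    rintro a ha _ ⟨n, rfl⟩
    rw [(hsa n).star_eq]
    exact hcomm a ha _ ⟨n, rfl⟩
  let C := (StarAlgebra.adjoin ℂ (Set.range e)).topologicalClosure
  have mem_C (m : M) : e m ∈ C :=
    StarSubalgebra.le_topologicalClosure _ (StarAlgebra.subset_adjoin ℂ _ ⟨m, rfl⟩)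
  have hclosed : IsClosed (C : Set B) := StarSubalgebra.isClosed_topologicalClosure _
  have hadjoin := StarAlgebra.isMulCommutative_adjoin ℂ hcomm hcomm_star
  let _ : CommCStarAlgebra C :=
    { (inferInstance : CStarAlgebra C) with
      mul_comm := (StarSubalgebra.commRingTopologicalClosure _ hadjoin.is_comm.comm).mul_comm }
  let G := gelfandStarTransform C
  refine ⟨WeakDual.characterSpace ℂ C, inferInstance, inferInstance,
    C.subtype.comp (G.symm : C(WeakDual.characterSpace ℂ C, ℂ) →⋆ₐ[ℂ] C),
    (G : C →* C(WeakDual.characterSpace ℂ C, ℂ)).comp (e.codRestrict C mem_C),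
    Subtype.val_injective.comp G.symm.injective, fun m => ?_⟩
  exact congrArg Subtype.val (G.symm_apply_apply ⟨e m, mem_C m⟩)

end Gelfand

section Idempotents

open LeftHull Idem
open semiChars (point point_iff)

variable {S : Type u} [LeftCancelMonoid S]

namespace LeftHull

theorem tr_one : tr (1 : S) = 1 := by
  ext x y
  rw [mem_one]
  change y ∈ leftTranslation 1 x ↔ _
  rw [mem_leftTranslation, one_mul]

theorem inv_one' : (1 : LeftHull S)⁻¹ = 1 := Subtype.ext PEquiv.symm_refl

theorem mul_dom (g : LeftHull S) : g * (dom g).1 = g := by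
  ext x y
  rw [mem_mul]
  constructor
  · rintro ⟨z, hz, hy⟩
    obtain rfl := (dom g).eq_of_mem hz
    exact hy
  · exact fun hy => ⟨x, mem_dom.2 ⟨y, hy⟩, hy⟩

end LeftHull

theorem hullWord_append (l l' : List (S × S)) : hullWord (l ++ l') = hullWord l * hullWord l' := by
  rw [hullWord, List.map_append, List.prod_append, hullWord, hullWord]

theorem hullWord_one_pair (s : S) : hullWord [(1, s)] = tr s := by
  rw [hullWord, List.map_singleton, List.prod_singleton, tr_one, inv_one', one_mul]

theorem mem_idemOf {X : Set S} (hX : IsConstructible X) {x y : S} :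
    y ∈ (idemOf X hX).1 x ↔ x = y ∧ x ∈ X := by
  classical
  change y ∈ PEquiv.ofSet X x ↔ _
  rw [PEquiv.mem_ofSet_iff]
  constructor <;> rintro ⟨rfl, hx⟩ <;> exact ⟨rfl, hx⟩

namespace Idem

noncomputable instance : CommMonoid (Idem S) where
  mul_assoc p q r := Subtype.ext (mul_assoc p.1 q.1 r.1)
  one_mul := one_mul'
  mul_one p := (mul_comm' p 1).trans (one_mul' p)
  mul_comm := mul_comm'

variable (S) in
/-- The inclusion of the idempotents into the left inverse hull. -/
noncomputable def valHom : Idem S →* LeftHull S where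
  toFun p := p.1
  map_one' := rfl
  map_mul' _ _ := rfl

theorem mul_self (p : Idem S) : p * p = p := Subtype.ext p.2

theorem inv_val (p : Idem S) : p.1⁻¹ = p.1 := by
  ext x y
  rw [mem_inv]
  constructor <;> intro h <;> obtain rfl := p.eq_of_mem h <;> exact h

theorem val_mul_eq_mul_conj (h : LeftHull S) (p : Idem S) : p.1 * h = h * (conj h p).1 := by
  ext x y
  rw [mem_mul, mem_mul]
  constructor
  · rintro ⟨z, hz, hy⟩
    obtain rfl := p.eq_of_mem hy
    exact ⟨x, mem_conj.2 ⟨z, hz, hy⟩, hz⟩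
  · rintro ⟨z, hz, hy⟩
    obtain rfl := (conj h p).eq_of_mem hz
    obtain ⟨w, hw, hwp⟩ := mem_conj.1 hz
    obtain rfl := val_unique hw hy
    exact ⟨w, hw, hwp⟩

/-- The constructible ideal whose identity map is `p`. -/
def support (p : Idem S) : Set S := {x | x ∈ p.1.1 x}

theorem mem_support {p : Idem S} {s : S} : s ∈ p.support ↔ (point s).1 p = true := point_iff.symm

theorem support_mul (p q : Idem S) : (p * q).support = p.support ∩ q.support :=
  Set.ext fun _ => mem_mul_iff

theorem support_injective : Function.Injective (support : Idem S → Set S) :=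
  fun _ _ h => ext' (Set.ext_iff.1 h)

theorem isConstructible_support (p : Idem S) : IsConstructible p.support := by
  obtain ⟨l, hl⟩ := exists_hullWord p.1
  refine ⟨l, Set.ext fun x => ?_⟩
  rw [hl]
  refine ⟨fun h => ⟨x, h⟩, ?_⟩
  rintro ⟨y, hy⟩
  obtain rfl := p.eq_of_mem hy
  exact hy

theorem idemOf_support (p : Idem S) : idemOf p.support p.isConstructible_support = p.1 := by
  ext x y
  rw [mem_idemOf]
  constructor
  · rintro ⟨rfl, h⟩
    exact h
  · intro h
    obtain rfl := p.eq_of_mem h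
    exact ⟨rfl, h⟩

/-- The idempotent `p_X` of a constructible ideal `X`, as an element of `Idem S`. -/
noncomputable def ofSet (X : Set S) (hX : IsConstructible X) : Idem S :=
  ⟨idemOf X hX, isIdempotentElem_iff.2 fun _ _ h => ((mem_idemOf hX).1 h).1⟩

theorem support_ofSet {X : Set S} (hX : IsConstructible X) : (ofSet X hX).support = X :=
  Set.ext fun _ => (mem_idemOf hX).trans (and_iff_right rfl)

theorem support_eq_empty_iff {p : Idem S} : p.support = ∅ ↔ p.1.1 = ⊥ := by
  rw [Set.eq_empty_iff_forall_notMem]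
  constructor
  · refine fun h => PEquiv.ext fun x => Option.eq_none_iff_forall_not_mem.2 fun y hy => ?_
    obtain rfl := p.eq_of_mem hy
    exact h x hy
  · intro h x hx
    rw [support, Set.mem_ofPred_eq, h] at hx
    exact Option.not_mem_none _ hx

/-- The ideals of the members of `L` cover the ideal of `q`. For `L = []` this says that `q` is
the map `0` with empty domain. -/
def IsCover (q : Idem S) (L : List (Idem S)) : Prop :=
  ∀ s ∈ q.support, ∃ p ∈ L, s ∈ p.support

end Idem

end Idempotents

section Covers

variable {S : Type u} [LeftCancelMonoid S]

theorem prod_map_mul_left_of_commute {R ι : Type*} [Monoid R] {e : R} {f : ι → R} {L : List ι}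
    (h : ∀ i ∈ L, Commute e (f i)) :
    (L.map fun i => e * f i).prod = e ^ L.length * (L.map f).prod := by
  induction L with
  | nil => simp only [List.map_nil, List.prod_nil, List.length_nil, pow_zero, mul_one]
  | cons i L ih =>
    obtain ⟨hi, hL⟩ := List.forall_mem_cons.1 h
    simp only [List.map_cons, List.prod_cons, List.length_cons]
    rw [ih hL, (hi.pow_left _).symm.mul_mul_mul_comm, pow_succ']

theorem prod_map_sub_map_mul {M R : Type*} [CommMonoid M] [Ring R] (e : M →* R) {q : M}
    (hq : q * q = q) {L : List M} (hL : L ≠ []) :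
    (L.map fun p => e q - e (q * p)).prod = e q * (L.map fun p => 1 - e p).prod := by
  have hcomm (p : M) : Commute (e q) (1 - e p) :=
    (Commute.one_right _).sub_right ((Commute.all q p).map e)
  have hidem : IsIdempotentElem (e q) := by rw [IsIdempotentElem, ← map_mul, hq]
  have hfactor (p : M) : e q - e (q * p) = e q * (1 - e p) := by rw [mul_sub, mul_one, map_mul]
  simp only [hfactor]
  rw [prod_map_mul_left_of_commute fun p _ => hcomm p,
    hidem.pow_eq (List.length_pos_iff.2 hL).ne']

/-- Finite covers of constructible ideals are sent to the relation `e q * ∏ (1 - e p) = 0`. The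
empty cover of the empty ideal is included, so that this comprises (R3) as well as (R4). -/
def RespectsCovers {R : Type*} [Ring R] (e : Idem S → R) : Prop :=
  ∀ ⦃q : Idem S⦄ ⦃L : List (Idem S)⦄, q.IsCover L → e q * (L.map fun p => 1 - e p).prod = 0

theorem map_mul_prod_one_sub {ι R R' : Type*} [Ring R] [Ring R'] (J : R →+* R') (a : R)
    (f : ι → R) (L : List ι) :
    J (a * (L.map fun i => 1 - f i).prod) = J a * (L.map fun i => 1 - J (f i)).prod := by
  rw [map_mul, map_list_prod, List.map_map]
  simp only [Function.comp_def, map_sub, map_one]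

theorem RespectsCovers.map {R R' : Type*} [Ring R] [Ring R'] {e : Idem S → R}
    (he : RespectsCovers e) (J : R →+* R') : RespectsCovers fun p => J (e p) := fun q L h => by
  rw [← map_mul_prod_one_sub, he h, map_zero]

theorem RespectsCovers.of_map {R R' : Type*} [Ring R] [Ring R'] {e : Idem S → R} {J : R →+* R'}
    (hJ : Function.Injective J) (he : RespectsCovers fun p => J (e p)) : RespectsCovers e :=
  fun q L h => hJ <| by rw [map_mul_prod_one_sub, he h, map_zero]

/-- A unital *-representation of the left inverse hull that respects finite covers of constructible
ideals. -/
structure IsHullRep {B : Type*} [Ring B] [StarRing B] (V : LeftHull S →* B) : Prop where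
  map_inv : ∀ g, V g⁻¹ = star (V g)
  respectsCovers : RespectsCovers fun p : Idem S => V p.1

theorem IsHullRep.comp {B B' : Type*} [Ring B] [StarRing B] [Ring B'] [StarRing B'] [Algebra ℂ B]
    [Algebra ℂ B'] {V : LeftHull S →* B} (hV : IsHullRep V) (φ : B →⋆ₐ[ℂ] B') :
    IsHullRep ((φ : B →* B').comp V) where
  map_inv g := (congrArg φ (hV.map_inv g)).trans (map_star φ _)
  respectsCovers := hV.respectsCovers.map (φ : B →+* B')

end Covers

section Relations

open LeftHull Idem

variable {S : Type u} {B : Type w} [Ring B] [StarRing B]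

theorem algWord_append (v : S → B) (l l' : List (S × S)) :
    algWord v (l ++ l') = algWord v l * algWord v l' := by
  rw [algWord, List.map_append, List.prod_append, algWord, algWord]

theorem star_algWord (v : S → B) (l : List (S × S)) :
    star (algWord v l) = algWord v (l.reverse.map Prod.swap) := by
  induction l with
  | nil => exact star_one B
  | cons x l ih =>
    rw [← List.singleton_append, algWord_append, star_mul, ih, List.reverse_append,
      List.map_append, algWord_append]
    simp only [algWord, List.reverse_singleton, List.map_singleton, List.prod_singleton,
      Prod.fst_swap, Prod.snd_swap, star_mul, star_star]

variable [LeftCancelMonoid S]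

namespace HullRelations

variable {v : S → B}

theorem algElem_hullWord (hv : HullRelations v) (l : List (S × S)) :
    algElem v (hullWord l) = algWord v l :=
  hv.well_defined _ _ (exists_hullWord (hullWord l)).choose_spec

/-- The unital *-representation `g ↦ v_g` of the left inverse hull. -/
noncomputable def algElemHom (hv : HullRelations v) : LeftHull S →* B where
  toFun := algElem v
  map_one' := hv.algElem_hullWord []
  map_mul' g h := by
    obtain ⟨l, rfl⟩ := exists_hullWord g
    obtain ⟨l', rfl⟩ := exists_hullWord h
    rw [← hullWord_append, hv.algElem_hullWord, hv.algElem_hullWord, hv.algElem_hullWord,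
      algWord_append]

theorem algElemHom_tr (hv : HullRelations v) (s : S) : hv.algElemHom (tr s) = v s := by
  rw [← hullWord_one_pair]
  refine (hv.algElem_hullWord _).trans ?_
  rw [algWord, List.map_singleton, List.prod_singleton, hv.one, star_one, one_mul]

theorem prod_sub_eq_zero (hv : HullRelations v) {q : Idem S} {L : List (Idem S)} (hL : L ≠ [])
    (h : q.IsCover L) : (L.map fun p => algElem v q.1 - algElem v (q * p).1).prod = 0 := by
  have hunion : q.support = ⋃ i : Fin L.length, (q * L.get i).support := by
    refine (Set.iUnion_subset fun i => ?_).antisymm' fun s hs => ?_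
    · rw [support_mul]
      exact Set.inter_subset_left
    · obtain ⟨p, hp, hsp⟩ := h s hs
      obtain ⟨i, rfl⟩ := List.get_of_mem hp
      exact Set.mem_iUnion.2 ⟨i, mem_mul_iff.2 ⟨hs, hsp⟩⟩
  have := hv.union L.length q.support _ q.isConstructible_support
    (fun i => (q * L.get i).isConstructible_support) (List.length_pos_iff.2 hL) hunion
  simp only [idemOf_support] at this
  rwa [← List.ofFn_get L, List.map_ofFn]

theorem isHullRep (hv : HullRelations v) : IsHullRep hv.algElemHom where
  map_inv g := by
    change algElem v g⁻¹ = star (algElem v g)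
    obtain ⟨l, rfl⟩ := exists_hullWord g
    rw [hullWord_inv, hv.algElem_hullWord, hv.algElem_hullWord, star_algWord]
  respectsCovers q L h := by
    rcases eq_or_ne L [] with rfl | hL
    · have hq : q.support = ∅ :=
        Set.eq_empty_of_forall_notMem fun s hs => by simpa using h s hs
      rw [List.map_nil, List.prod_nil, mul_one]
      exact hv.zero _ (support_eq_empty_iff.1 hq)
    · exact (prod_map_sub_map_mul (hv.algElemHom.comp (valHom S)) q.mul_self hL).symm.trans
        (hv.prod_sub_eq_zero hL h)

end HullRelations

namespace IsHullRep

variable {V : LeftHull S →* B}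

theorem algWord_eq (hV : IsHullRep V) (l : List (S × S)) :
    algWord (fun s => V (tr s)) l = V (hullWord l) := by
  rw [hullWord, map_list_prod, List.map_map, algWord]
  congr 1
  refine List.map_congr_left fun x _ => ?_
  rw [Function.comp_apply, map_mul, hV.map_inv]

theorem algElem_eq (hV : IsHullRep V) (g : LeftHull S) : algElem (fun s => V (tr s)) g = V g := by
  rw [algElem, hV.algWord_eq, (exists_hullWord g).choose_spec]

theorem hullRelations (hV : IsHullRep V) : HullRelations fun s => V (tr s) where
  one := by rw [tr_one, map_one]
  well_defined l l' h := by rw [hV.algWord_eq, hV.algWord_eq, h]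
  zero g hg := by
    let q : Idem S := ⟨g, isIdempotentElem_iff.2 fun x y h => by simp [hg] at h⟩
    have hq : q.support = ∅ := support_eq_empty_iff.2 hg
    have hcover : q.IsCover [] := fun s hs => absurd (hq ▸ hs) (Set.notMem_empty s)
    simpa only [hV.algElem_eq, List.map_nil, List.prod_nil, mul_one] using hV.respectsCovers hcover
  union n X Y hX hY hn hXY := by
    let L := List.ofFn fun i => ofSet (Y i) (hY i)
    have hL : L ≠ [] := List.ne_nil_of_length_pos (by rwa [List.length_ofFn])
    have hcover : (ofSet X hX).IsCover L := fun s hs => by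
      rw [support_ofSet, hXY] at hs
      obtain ⟨i, hi⟩ := Set.mem_iUnion.1 hs
      exact ⟨_, List.mem_ofFn.2 ⟨i, rfl⟩, by rwa [support_ofSet]⟩
    have hle (i : Fin n) : ofSet X hX * ofSet (Y i) (hY i) = ofSet (Y i) (hY i) :=
      support_injective <| by
        rw [support_mul, support_ofSet, support_ofSet, hXY]
        exact Set.inter_eq_right.2 (Set.subset_iUnion Y i)
    have := (prod_map_sub_map_mul (V.comp (valHom S)) (ofSet X hX).mul_self hL).trans
      (hV.respectsCovers hcover)
    simp only [L, List.map_ofFn, Function.comp_def, hle] at this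
    simp only [hV.algElem_eq]
    exact this

end IsHullRep

end Relations

section Omega

open Idem GP
open semiChars (omega map_mul_iff)

variable {S : Type u} [LeftCancelMonoid S]

theorem semiChars.map_prod_iff (χ : semiChars S) (P : Finset (Idem S)) :
    χ.1 (∏ p ∈ P, p) = true ↔ ∀ p ∈ P, χ.1 p = true := by
  classical
  induction P using Finset.induction_on with
  | empty => simp only [Finset.prod_empty, semiChars.map_one, Finset.notMem_empty, false_imp_iff,
      implies_true]
  | insert p P hp ih => rw [Finset.prod_insert hp, map_mul_iff, ih, Finset.forall_mem_insert]

/-- A basic neighbourhood of `χ` prescribes finitely many values `χ(p) = 1`, which amount to one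
such condition on their product, and finitely many values `χ(p) = 0`. It contains some `χ_s` unless
the ideals of the latter `p` cover the former. -/
theorem semiChars.mem_omega_iff {χ : semiChars S} :
    χ ∈ omega S ↔
      ∀ (q : Idem S) (L : List (Idem S)), q.IsCover L → χ.1 q = true → ∃ p ∈ L, χ.1 p = true := by
  classical
  rw [omega]
  constructor
  · intro hχ q L hcover hq
    by_contra! hL
    have hopen : IsOpen ({ψ : semiChars S | ψ.1 q = true} ∩
        ⋂ p ∈ L.toFinset, {ψ : semiChars S | ψ.1 p = true}ᶜ) :=
      (isClopen_eval q).isOpen.inter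
        (isOpen_biInter_finset fun p _ => (isClopen_eval p).compl.isOpen)
    obtain ⟨_, ⟨hsq, hsL⟩, s, rfl⟩ := mem_closure_iff.1 hχ _ hopen
      ⟨hq, Set.mem_iInter₂.2 fun p hp => hL p (List.mem_toFinset.1 hp)⟩
    obtain ⟨p, hp, hsp⟩ := hcover s (mem_support.2 hsq)
    exact Set.mem_iInter₂.1 hsL p (List.mem_toFinset.2 hp) (mem_support.1 hsp)
  · intro H
    rw [mem_closure_iff]
    intro O hO hχ
    obtain ⟨W, hW, rfl⟩ := isOpen_induced_iff.1 hO
    obtain ⟨I, u, hu, hIW⟩ := isOpen_pi_iff.1 hW χ.1 hχ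
    let q := ∏ p ∈ I with χ.1 p = true, p
    let L := {p ∈ I | χ.1 p ≠ true}.toList
    have hq : χ.1 q = true := (map_prod_iff χ _).2 fun p hp => (Finset.mem_filter.1 hp).2
    have hL : ¬ q.IsCover L := fun hcover => by
      obtain ⟨p, hp, hχp⟩ := H q L hcover hq
      exact (Finset.mem_filter.1 (Finset.mem_toList.1 hp)).2 hχp
    obtain ⟨s, hsq, hsL⟩ : ∃ s ∈ q.support, ∀ p ∈ L, s ∉ p.support := by
      simpa only [IsCover, not_forall, not_exists, not_and, exists_prop] using hL
    refine ⟨point s, hIW fun p hp => ?_, s, rfl⟩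
    have hsp : (point s).1 p = true ↔ χ.1 p = true := by
      refine ⟨fun h => ?_, fun h => ?_⟩
      · by_contra hχp
        exact hsL p (Finset.mem_toList.2 (Finset.mem_filter.2 ⟨hp, hχp⟩)) (mem_support.2 h)
      · exact (map_prod_iff _ _).1 (mem_support.1 hsq) p (Finset.mem_filter.2 ⟨hp, h⟩)
    rw [Bool.eq_iff_iff.2 hsp]
    exact (hu p hp).2

theorem GP.pull_val_one_apply (p : Idem S) (χ : omega S) :
    pull p.1 1 χ = if χ.1.1 p = true then 1 else 0 := by
  split_ifs with h
  · rw [pull_idem p 1 h, ContinuousMap.one_apply]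
  · rw [pull_neg]
    rwa [dom_idem]

/-- The indicator function of `{χ ∈ Ω(S) | χ(p) = 1}`, multiplicative in `p`. -/
noncomputable def idemInd : Idem S →* C(omega S, ℂ) where
  toFun p := pull p.1 1
  map_one' := ContinuousMap.ext fun χ => by
    rw [pull_val_one_apply, if_pos (semiChars.map_one χ.1), ContinuousMap.one_apply]
  map_mul' p q := ContinuousMap.ext fun χ => by
    rw [ContinuousMap.mul_apply]
    simp only [pull_val_one_apply, map_mul_iff, ite_and, mul_ite, mul_one, mul_zero]
    split_ifs <;> rfl

theorem idemInd_apply (p : Idem S) (χ : omega S) :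
    idemInd p χ = if χ.1.1 p = true then 1 else 0 := pull_val_one_apply p χ

theorem idemInd_apply_of_pos {p : Idem S} {χ : omega S} (h : χ.1.1 p = true) :
    idemInd p χ = 1 := by rw [idemInd_apply, if_pos h]

theorem idemInd_apply_of_neg {p : Idem S} {χ : omega S} (h : ¬ χ.1.1 p = true) :
    idemInd p χ = 0 := by rw [idemInd_apply, if_neg h]

theorem star_idemInd (p : Idem S) : star (idemInd p) = idemInd p := by
  ext χ
  rw [ContinuousMap.star_apply, idemInd_apply]
  split_ifs
  exacts [star_one ℂ, star_zero ℂ]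

theorem pull_idemInd (h : LeftHull S) (p : Idem S) : pull h (idemInd p) = idemInd (conj h p) := by
  ext χ
  by_cases hh : χ.1.1 (dom h) = true
  · rw [pull_pos _ hh]
    by_cases hp : χ.1.1 (conj h p) = true
    · rw [idemInd_apply_of_pos hp]
      exact idemInd_apply_of_pos hp
    · rw [idemInd_apply_of_neg hp]
      exact idemInd_apply_of_neg hp
  · rw [pull_neg _ hh, idemInd_apply_of_neg]
    rw [← mul_one p, conj_mul', conj_one, map_mul_iff]
    exact fun hp => hh hp.2

/-- `φ ↦ pull h φ`, as a continuous linear map. -/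
noncomputable def pullCLM (h : LeftHull S) : C(omega S, ℂ) →L[ℂ] C(omega S, ℂ) :=
  LinearMap.mkContinuous
    { toFun := pull h
      map_add' := fun φ ψ => by
        ext χ
        by_cases hχ : χ.1.1 (dom h) = true
        · simp only [ContinuousMap.add_apply, pull_pos _ hχ]
        · simp only [ContinuousMap.add_apply, pull_neg _ hχ, add_zero]
      map_smul' := fun c φ => by
        ext χ
        by_cases hχ : χ.1.1 (dom h) = true
        · simp only [RingHom.id_apply, ContinuousMap.smul_apply, pull_pos _ hχ]
        · simp only [RingHom.id_apply, ContinuousMap.smul_apply, pull_neg _ hχ, smul_zero] }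
    1 fun φ => by
      rw [one_mul]
      refine (ContinuousMap.norm_le _ (norm_nonneg φ)).2 fun χ => ?_
      by_cases hχ : χ.1.1 (dom h) = true
      · exact (congrArg norm (pull_pos φ hχ)).trans_le (φ.norm_coe_le_norm _)
      · exact (congrArg norm (pull_neg φ hχ)).trans_le (norm_zero.trans_le (norm_nonneg φ))

theorem respectsCovers_idemInd : RespectsCovers (idemInd : Idem S → C(omega S, ℂ)) := by
  intro q L hcover
  ext χ
  refine (map_mul_prod_one_sub (ContinuousMap.evalStarAlgHom ℂ ℂ χ : C(omega S, ℂ) →+* ℂ)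
    (idemInd q) idemInd L).trans ?_
  change idemInd q χ * (L.map fun p => 1 - idemInd p χ).prod = 0
  by_cases hq : χ.1.1 q = true
  · obtain ⟨p, hp, hχp⟩ := semiChars.mem_omega_iff.1 χ.2 q L hcover hq
    rw [List.prod_eq_zero (List.mem_map.2 ⟨p, hp, by rw [idemInd_apply_of_pos hχp, sub_self]⟩),
      mul_zero]
  · rw [idemInd_apply_of_neg hq, zero_mul]

theorem exists_idemInd_apply_eq {e : Idem S →* ℂ} (he : RespectsCovers e) :
    ∃ χ : omega S, ∀ p, idemInd p χ = e p := by
  classical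
  have he01 (p : Idem S) : e p = 0 ∨ e p = 1 :=
    IsIdempotentElem.iff_eq_zero_or_one.1 <| by rw [IsIdempotentElem, ← map_mul, p.mul_self]
  let χ : semiChars S := ⟨fun p => decide (e p = 1), fun p q => by
    rcases he01 p with hp | hp <;> simp [hp], 1, by simp⟩
  have hχ (p : Idem S) : χ.1 p = true ↔ e p = 1 := decide_eq_true_iff
  refine ⟨⟨χ, semiChars.mem_omega_iff.2 fun q L hcover hq => ?_⟩, fun p => ?_⟩
  · have hprod : (L.map fun p => 1 - e p).prod = 0 := by
      simpa only [(hχ q).1 hq, one_mul] using he hcover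
    obtain ⟨p, hp, hep⟩ := List.mem_map.1 (List.prod_eq_zero_iff.1 hprod)
    exact ⟨p, hp, (hχ p).2 (sub_eq_zero.1 hep).symm⟩
  · rw [idemInd_apply]
    rcases he01 p with h | h <;> simp [hχ, h]

theorem continuous_omega_of_idemInd {K : Type*} [TopologicalSpace K] {Y : K → omega S}
    (hY : ∀ p, Continuous fun k => idemInd p (Y k)) : Continuous Y := by
  refine (continuous_pi fun p => (continuous_bool_rng true).2 ?_).subtype_mk _ |>.subtype_mk _
  have hone : (fun k => (Y k).1.1 p) ⁻¹' {true} = (fun k => idemInd p (Y k)) ⁻¹' {1} := by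
    ext k
    simp [idemInd_apply]
  have hzero : (fun k => (Y k).1.1 p) ⁻¹' {true} = (fun k => idemInd p (Y k)) ⁻¹' {0}ᶜ := by
    ext k
    simp [idemInd_apply]
  exact ⟨hone ▸ isClosed_singleton.preimage (hY p),
    hzero ▸ isClosed_singleton.isOpen_compl.preimage (hY p)⟩

theorem exists_continuousMap_omega {K : Type*} [TopologicalSpace K] {f : Idem S →* C(K, ℂ)}
    (hf : RespectsCovers f) : ∃ Y : C(K, omega S), ∀ p k, idemInd p (Y k) = f p k := by
  have heval (k : K) := exists_idemInd_apply_eq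
    (e := (ContinuousMap.evalStarAlgHom ℂ ℂ k : C(K, ℂ) →* ℂ).comp f)
    (hf.map (ContinuousMap.evalStarAlgHom ℂ ℂ k : C(K, ℂ) →+* ℂ))
  choose Y hY using heval
  exact ⟨⟨Y, continuous_omega_of_idemInd fun p =>
    (f p).continuous.congr fun k => (hY k p).symm⟩,
    fun p k => hY k p⟩

theorem dense_span_idemInd :
    Dense (Submodule.span ℂ (Set.range (idemInd : Idem S → C(omega S, ℂ))) :
      Set C(omega S, ℂ)) := by
  let A : StarSubalgebra ℂ C(omega S, ℂ) := StarAlgebra.adjoin ℂ (Set.range idemInd)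
  have hA : A.topologicalClosure = ⊤ := by
    refine ContinuousMap.starSubalgebra_topologicalClosure_eq_top_of_separatesPoints A
      fun χ ψ hne => ?_
    obtain ⟨p, hp⟩ : ∃ p, ¬ (χ.1.1 p = true ↔ ψ.1.1 p = true) := by
      by_contra! h
      exact hne (Subtype.ext (semiChars.ext' h))
    refine ⟨idemInd p, ⟨idemInd p, StarAlgebra.subset_adjoin ℂ _ ⟨p, rfl⟩, rfl⟩, fun h => hp ?_⟩
    by_contra hne
    rw [idemInd_apply, idemInd_apply] at h
    split_ifs at h <;> simp_all
  have hstar : star (Set.range (idemInd (S := S))) = Set.range idemInd := by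
    ext φ
    constructor
    · rintro ⟨p, hp⟩
      exact ⟨p, by rw [← star_idemInd, hp, star_star]⟩
    · rintro ⟨p, rfl⟩
      exact ⟨p, (star_idemInd p).symm⟩
  have hmul : (Submonoid.closure (Set.range (idemInd (S := S))) : Set C(omega S, ℂ)) =
      Set.range idemInd := by
    rw [← MonoidHom.coe_mrange, Submonoid.closure_eq]
  have hspan : Subalgebra.toSubmodule A.toSubalgebra =
      Submodule.span ℂ (Set.range (idemInd : Idem S → C(omega S, ℂ))) := by
    rw [StarAlgebra.adjoin_toSubalgebra, hstar, Set.union_self, Algebra.adjoin_eq_span, hmul]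
  rw [dense_iff_closure_eq, ← hspan]
  exact (congrArg (fun A : StarSubalgebra ℂ _ => (A : Set C(omega S, ℂ))) hA)

end Omega

section Generators

open LeftHull GP
open semiChars (omega)

variable {S : Type u} [LeftCancelMonoid S]

namespace CcAlg

theorem d_one_mul_d_one (g h : LeftHull S) : d g 1 * d h 1 = d (g * h) 1 := by
  rw [d_mul]
  refine d_congr fun χ hχ => ?_
  obtain ⟨hh, -⟩ := (semiChars.dom_mul_iff _ _ _).1 hχ
  rw [mul_one, pull_pos _ hh, ContinuousMap.one_apply, ContinuousMap.one_apply]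

theorem star_d_one (g : LeftHull S) : star (d g 1) = d g⁻¹ 1 := by
  rw [d_star]
  refine d_congr fun χ hχ => ?_
  rw [star_one, pull_pos _ hχ, ContinuousMap.one_apply, ContinuousMap.one_apply]

theorem d_eq_mul (g : LeftHull S) (φ : C(omega S, ℂ)) : d g φ = d g 1 * d 1 φ := by
  rw [d_mul, mul_one, pull_one, one_mul]

theorem d_val_one (p : Idem S) : d p.1 1 = d 1 (idemInd p) := by
  have h := star_d_mul_d p.1 1
  rwa [star_one, mul_one, mul_one, star_d_one, d_one_mul_d_one, p.inv_val, p.2.eq] at h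

variable (S) in
/-- The canonical representation `g ↦ 𝟙_{D(g, Ω(S))}` of the left inverse hull. -/
noncomputable def indHom : LeftHull S →* CcAlg S where
  toFun g := d g 1
  map_one' := rfl
  map_mul' g h := (d_one_mul_d_one g h).symm

variable (S) in
/-- The inclusion of the continuous functions on the unit space `Ω(S)`. -/
noncomputable def unitsHom : C(omega S, ℂ) →⋆ₐ[ℂ] CcAlg S where
  toFun φ := d 1 φ
  map_one' := rfl
  map_mul' := d_one_mul
  map_zero' := by simpa only [zero_smul] using d_smul (S := S) 1 0 0
  map_add' := d_add 1
  commutes' c := by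
    rw [Algebra.algebraMap_eq_smul_one, Algebra.algebraMap_eq_smul_one, d_smul]
    rfl
  map_star' := d_one_star

theorem isHullRep_indHom : IsHullRep (indHom S) where
  map_inv g := (star_d_one g).symm
  respectsCovers := by
    have hunits : (fun p : Idem S => indHom S p.1) = fun p => unitsHom S (idemInd p) :=
      funext d_val_one
    rw [hunits]
    exact respectsCovers_idemInd.map (unitsHom S : C(omega S, ℂ) →+* CcAlg S)

end CcAlg

open CcAlg

variable (S) in
/-- The representation `g ↦ 𝟙_{D(g, Ω(S))}` of the left inverse hull in `C*(𝒢_P(S))`. -/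
noncomputable def gpRep : LeftHull S →* FullGPAlgebra S :=
  (CStarEnvelope.of (CcAlg S) : CcAlg S →* FullGPAlgebra S).comp (indHom S)

theorem isHullRep_gpRep : IsHullRep (gpRep S) := isHullRep_indHom.comp (CStarEnvelope.of (CcAlg S))

theorem gpGenerator_eq (s : S) :
    gpGenerator s = CStarEnvelope.of (CcAlg S) (d (tr s) 1) := by
  rw [gpGenerator]
  exact congrArg (CStarEnvelope.of (CcAlg S)) (Subtype.ext rfl)

theorem gpRep_tr (s : S) : gpRep S (tr s) = gpGenerator s := (gpGenerator_eq s).symm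

theorem hullRelations_gpGenerator : HullRelations (gpGenerator : S → FullGPAlgebra S) := by
  simpa only [gpRep_tr] using (isHullRep_gpRep (S := S)).hullRelations

theorem gpRep_mem_adjoin (g : LeftHull S) :
    gpRep S g ∈ StarAlgebra.adjoin ℂ (Set.range (gpGenerator : S → FullGPAlgebra S)) := by
  obtain ⟨l, rfl⟩ := exists_hullWord g
  rw [← isHullRep_gpRep.algWord_eq]
  simp only [gpRep_tr]
  refine list_prod_mem fun x hx => ?_
  obtain ⟨y, -, rfl⟩ := List.mem_map.1 hx
  exact mul_mem (star_mem (StarAlgebra.subset_adjoin ℂ _ ⟨_, rfl⟩))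
    (StarAlgebra.subset_adjoin ℂ _ ⟨_, rfl⟩)

open scoped CStarAlgebra in
theorem adjoin_gpGenerator_dense :
    (StarAlgebra.adjoin ℂ (Set.range (gpGenerator : S → FullGPAlgebra S))).topologicalClosure =
      ⊤ := by
  set A := (StarAlgebra.adjoin ℂ (Set.range (gpGenerator : S → FullGPAlgebra S))).topologicalClosure
  have hclosed : IsClosed (A : Set (FullGPAlgebra S)) :=
    StarSubalgebra.isClosed_topologicalClosure _
  have hrep (g : LeftHull S) : gpRep S g ∈ A :=
    StarSubalgebra.le_topologicalClosure _ (gpRep_mem_adjoin g)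
  let Φ := (CStarEnvelope.of (CcAlg S)).comp (unitsHom S)
  have hidem (p : Idem S) : Φ (idemInd p) = gpRep S p.1 :=
    congrArg (CStarEnvelope.of (CcAlg S)) (d_val_one p).symm
  have hunits (φ : C(omega S, ℂ)) : Φ φ ∈ A := by
    have hspan : Submodule.span ℂ (Set.range (idemInd : Idem S → C(omega S, ℂ))) ≤
        (Subalgebra.toSubmodule A.toSubalgebra).comap Φ.toAlgHom.toLinearMap :=
      Submodule.span_le.2 <| Set.range_subset_iff.2 fun p =>
        show Φ (idemInd p) ∈ A from hidem p ▸ hrep p.1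
    exact closure_minimal hspan (hclosed.preimage (map_continuous Φ)) (dense_span_idemInd φ)
  have hof (f : CcAlg S) : CStarEnvelope.of (CcAlg S) f ∈ A := by
    induction f using CcAlg.induction with
    | hd g φ =>
      rw [d_eq_mul, map_mul]
      exact mul_mem (hrep g) (hunits φ)
    | h0 => rw [map_zero]; exact zero_mem A
    | hadd f f' h h' => rw [map_add]; exact add_mem h h'
    | hsmul c f h => rw [map_smul]; exact A.smul_mem h c
  exact eq_top_iff.2 fun x _ =>
    (maxCStarSeminorm (CcAlg S)).induction (P := fun x => x ∈ A) x hclosed hof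

end Generators

section Localization

variable {X : Type*} [TopologicalSpace X] [CompactSpace X] [T2Space X]

/-- Freeze each `φ i` at the centre of each member of a partition of unity that is fine enough. -/
theorem exists_finite_approximation {ι : Type*} (I : Finset ι) (φ : ι → C(X, ℂ)) {U : X → Set X}
    (hU : ∀ x, IsOpen (U x)) (hxU : ∀ x, x ∈ U x) {ε : ℝ} (hε : 0 < ε) :
    ∃ (t : Finset X) (h : t → C(X, ℂ)), (∀ x, ∀ y ∉ U x.1, h x y = 0) ∧
      ∀ i ∈ I, ‖φ i - ∑ x, φ i x.1 • h x‖ ≤ ε := by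
  let V (x : X) : Set X := U x ∩ ⋂ i ∈ I, {y | dist (φ i y) (φ i x) < ε}
  have hV (x : X) : IsOpen (V x) :=
    (hU x).inter (isOpen_biInter_finset fun i _ => isOpen_lt (by fun_prop) continuous_const)
  have hxV (x : X) : x ∈ V x :=
    ⟨hxU x, Set.mem_iInter₂.2 fun i _ => (dist_self _).trans_lt hε⟩
  obtain ⟨t, ht⟩ := isCompact_univ.elim_finite_subcover V hV
    fun x _ => Set.mem_iUnion.2 ⟨x, hxV x⟩
  obtain ⟨f, hf⟩ := PartitionOfUnity.exists_isSubordinate (ι := t) isClosed_univ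
    (fun x => V x.1) (fun x => hV x.1)
    (ht.trans_eq (Set.biUnion_eq_iUnion (t : Set X) fun x _ => V x))
  have hf0 (x : t) (y : X) (hy : y ∉ V x.1) : f x y = 0 :=
    Function.notMem_support.1 fun hne => hy (hf x (subset_closure hne))
  refine ⟨t, fun x => ⟨fun y => f x y, by fun_prop⟩, fun x y hy => ?_, fun i hi => ?_⟩
  · exact (congrArg Complex.ofReal (hf0 x y fun hyV => hy hyV.1)).trans Complex.ofReal_zero
  · refine (ContinuousMap.norm_le _ hε.le).2 fun y => ?_
    have hmem : ∑ᶠ x, f x y • φ i x.1 ∈ Metric.closedBall (φ i y) ε := by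
      refine f.finsum_smul_mem_convex (g := fun x _ => φ i x.1) (Set.mem_univ y) (fun x hx => ?_)
        (convex_closedBall _ _)
      have hyV : y ∈ V x.1 := by
        by_contra hy
        exact hx (hf0 x y hy)
      exact Metric.mem_closedBall.2
        ((dist_comm _ _).trans_le (Set.mem_iInter₂.1 hyV.2 i hi).le)
    rw [finsum_eq_sum_of_fintype, Metric.mem_closedBall, dist_comm, dist_eq_norm] at hmem
    simpa [ContinuousMap.sum_apply, mul_comm] using hmem

variable {E : Type*} [NormedAddCommGroup E] [NormedSpace ℂ E]

/-- The hypothesis replaces each `φ i` by its value at `x`; the error is absorbed by a partition of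
unity. -/
theorem sum_apply_eq_zero_of_locally {ι : Type*} (I : Finset ι) (φ : ι → C(X, ℂ))
    (Λ : ι → C(X, ℂ) →L[ℂ] E)
    (H : ∀ x : X, ∃ U : Set X, IsOpen U ∧ x ∈ U ∧ ∀ h : C(X, ℂ), (∀ y ∉ U, h y = 0) →
      ∑ i ∈ I, φ i x • Λ i h = 0) : ∑ i ∈ I, Λ i (φ i) = 0 := by
  choose U hU hxU hsum using H
  suffices hε : ∀ ε : ℝ, 0 < ε → ‖∑ i ∈ I, Λ i (φ i)‖ ≤ (∑ i ∈ I, ‖Λ i‖) * ε by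
    have hlim : Filter.Tendsto (fun ε : ℝ => (∑ i ∈ I, ‖Λ i‖) * ε) (nhdsWithin 0 (Set.Ioi 0))
        (nhds 0) :=
      tendsto_nhdsWithin_of_tendsto_nhds <|
        (continuous_const_mul (∑ i ∈ I, ‖Λ i‖)).tendsto' 0 0 (mul_zero _)
    exact norm_le_zero_iff.1 (ge_of_tendsto hlim (Filter.eventually_of_mem self_mem_nhdsWithin hε))
  intro ε hε
  obtain ⟨t, h, hzero, happrox⟩ := exists_finite_approximation I φ hU hxU hε
  have hfrozen : ∑ i ∈ I, Λ i (∑ x, φ i x.1 • h x) = 0 := by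
    simp only [map_sum, map_smul]
    rw [Finset.sum_comm]
    exact Finset.sum_eq_zero fun x _ => hsum x.1 (h x) (hzero x)
  calc ‖∑ i ∈ I, Λ i (φ i)‖ = ‖∑ i ∈ I, Λ i (φ i - ∑ x, φ i x.1 • h x)‖ := by
        simp only [map_sub, Finset.sum_sub_distrib, hfrozen, sub_zero]
    _ ≤ ∑ i ∈ I, ‖Λ i‖ * ε := norm_sum_le_of_le I fun i hi =>
        (Λ i).le_opNorm_of_le (happrox i hi)
    _ = (∑ i ∈ I, ‖Λ i‖) * ε := (Finset.sum_mul ..).symm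

end Localization

section GermCompatible

open Idem GP CcAlg
open semiChars (omega map_mul_iff)

variable {S : Type u} [LeftCancelMonoid S]

theorem Idem.dom_mul_val (g : LeftHull S) (p : Idem S) : dom (g * p.1) = p * dom g := by
  rw [← conj_dom, conj_idem]

theorem Idem.mul_mul_val_congr {a b : LeftHull S} {p : Idem S} (hp : a * p.1 = b * p.1)
    (q : Idem S) : a * (p * q).1 = b * (p * q).1 := by
  change a * (p.1 * q.1) = b * (p.1 * q.1)
  rw [← mul_assoc, ← mul_assoc, hp]

/-- Two elements of the left inverse hull agree near `χ` if they coincide on an ideal `p` with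
`χ(p) = 1`. For elements whose domain contains `χ` this is equality of germs at `χ`. -/
def agreeSetoid (χ : semiChars S) : Setoid (LeftHull S) where
  r a b := ∃ p : Idem S, a * p.1 = b * p.1 ∧ χ.1 p = true
  iseqv :=
    { refl := fun _ => ⟨1, rfl, semiChars.map_one χ⟩
      symm := fun ⟨p, hp, hχ⟩ => ⟨p, hp.symm, hχ⟩
      trans := fun {a b c} ⟨p, hp, hχp⟩ ⟨q, hq, hχq⟩ =>
        ⟨p * q, by
          calc a * (p * q).1 = b * (p * q).1 := mul_mul_val_congr hp q
            _ = c * (p * q).1 := by rw [mul_comm p q]; exact mul_mul_val_congr hq p,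
          (map_mul_iff _ _ _).2 ⟨hχp, hχq⟩⟩ }

theorem dom_iff_of_agree {χ : semiChars S} {a b : LeftHull S} (hab : agreeSetoid χ a b) :
    χ.1 (dom a) = true ↔ χ.1 (dom b) = true := by
  obtain ⟨p, hp, hχ⟩ := hab
  have hdom : p * dom a = p * dom b := by rw [← dom_mul_val, ← dom_mul_val, hp]
  have h := congrArg (χ.1 · = true) hdom
  simpa only [map_mul_iff, hχ, true_and, eq_iff_iff] using h

theorem exists_forall_agree (χ : semiChars S) (I : Finset (LeftHull S)) :
    ∃ p : Idem S, χ.1 p = true ∧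
      ∀ a ∈ I, ∀ b ∈ I, agreeSetoid χ a b → a * p.1 = b * p.1 := by
  classical
  have hpair (a b : LeftHull S) :
      ∃ p : Idem S, χ.1 p = true ∧ (agreeSetoid χ a b → a * p.1 = b * p.1) := by
    by_cases hab : agreeSetoid χ a b
    · obtain ⟨p, hp, hχ⟩ := hab
      exact ⟨p, hχ, fun _ => hp⟩
    · exact ⟨1, semiChars.map_one χ, fun h => absurd h hab⟩
  choose p hχ hp using hpair
  refine ⟨∏ q ∈ (I ×ˢ I).image fun x => p x.1 x.2, q, (semiChars.map_prod_iff χ _).2 fun q hq => ?_,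
    fun a ha b hb hab => ?_⟩
  · obtain ⟨x, -, rfl⟩ := Finset.mem_image.1 hq
    exact hχ _ _
  · obtain ⟨q, hq⟩ := Finset.dvd_prod_of_mem (fun q => q)
      (Finset.mem_image_of_mem (fun x => p x.1 x.2) (Finset.mk_mem_product ha hb))
    rw [hq]
    exact mul_mul_val_congr (hp a b hab) q

open Classical in
theorem GP.delta_germ_eq_ite (a : LeftHull S) (φ : C(omega S, ℂ)) {g : LeftHull S} {χ : omega S}
    (hg : χ.1.1 (dom g) = true) :
    delta a φ (germ g χ hg) = if agreeSetoid χ.1 a g then φ χ else 0 := by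
  split_ifs with hag
  · have ha := (dom_iff_of_agree hag).2 hg
    rw [← germ_eq_iff (h := ha).2 ⟨rfl, hag⟩, delta_germ]
  · refine delta_of_notMem φ fun ⟨χ', h, hgerm⟩ => hag ?_
    obtain ⟨rfl, hga⟩ := germ_eq_iff.1 hgerm
    exact (agreeSetoid χ.1).symm hga

open Classical in
theorem sum_agree_apply_eq_zero {I : Finset (LeftHull S)} {φ : LeftHull S → C(omega S, ℂ)}
    (hφ : ∑ g ∈ I, d g (φ g) = 0) (χ : omega S) (g : LeftHull S) :
    ∑ a ∈ I with agreeSetoid χ.1 a g, (idemInd (dom a) * φ a) χ = 0 := by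
  by_cases hχg : χ.1.1 (dom g) = true
  · let ev : CcAlg S →+ ℂ :=
      { toFun := fun f => f.1 (germ g χ hχg), map_zero' := rfl, map_add' := fun _ _ => rfl }
    have hgerm : ∑ a ∈ I, delta a (φ a) (germ g χ hχg) = 0 :=
      (map_sum ev _ I).symm.trans ((congrArg ev hφ).trans (map_zero ev))
    rw [← hgerm]
    simp only [delta_germ_eq_ite, ← Finset.sum_filter]
    refine Finset.sum_congr rfl fun a ha => ?_
    rw [ContinuousMap.mul_apply, idemInd_apply_of_pos, one_mul]
    exact (dom_iff_of_agree (Finset.mem_filter.1 ha).2).2 hχg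
  · refine Finset.sum_eq_zero fun a ha => ?_
    rw [ContinuousMap.mul_apply, idemInd_apply_of_neg, zero_mul]
    rwa [dom_iff_of_agree (Finset.mem_filter.1 ha).2]

variable {E : Type*} [NormedAddCommGroup E] [NormedSpace ℂ E]

/-- A family of continuous linear maps `Λ_g` on `C(Ω(S))` is germ compatible if `Λ_g φ` depends only
on `φ` on the domain of `g`, and `Λ_a φ = Λ_b φ` for `φ` supported where `a` and `b` agree. These
relations, which hold for the functions `d g φ`, generate all linear relations between them. -/
structure IsGermCompatible (Λ : LeftHull S → C(omega S, ℂ) →L[ℂ] E) : Prop where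
  map_idemInd_dom_mul : ∀ g φ, Λ g (idemInd (dom g) * φ) = Λ g φ
  map_idemInd_mul_congr : ∀ {a b : LeftHull S} {p : Idem S}, a * p.1 = b * p.1 →
    ∀ φ, Λ a (idemInd p * φ) = Λ b (idemInd p * φ)

namespace IsGermCompatible

variable {Λ : LeftHull S → C(omega S, ℂ) →L[ℂ] E}

/-- At `χ`, the terms are grouped by germs: `Λ_a f` is constant on a group, and its coefficients sum
to the value of `∑ d g (φ g)` at that germ. -/
theorem sum_apply_eq_zero (hΛ : IsGermCompatible Λ) {I : Finset (LeftHull S)}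
    {φ : LeftHull S → C(omega S, ℂ)} (hφ : ∑ g ∈ I, d g (φ g) = 0) :
    ∑ g ∈ I, Λ g (φ g) = 0 := by
  classical
  simp only [← hΛ.map_idemInd_dom_mul _ (φ _)]
  refine sum_apply_eq_zero_of_locally I (fun g => idemInd (dom g) * φ g) Λ fun χ => ?_
  obtain ⟨p, hχp, hp⟩ := exists_forall_agree χ.1 I
  refine ⟨{ψ | ψ.1.1 p = true}, (isClopen_domΩ p).isOpen, hχp, fun f hf => ?_⟩
  have hpf : idemInd p * f = f := by
    ext ψ
    by_cases hψ : ψ.1.1 p = true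
    · rw [ContinuousMap.mul_apply, idemInd_apply_of_pos hψ, one_mul]
    · rw [ContinuousMap.mul_apply, hf ψ hψ, mul_zero]
  refine Finset.sum_cancels_of_partition_cancels (agreeSetoid χ.1) fun g hg => ?_
  have hconst : ∀ a ∈ I, agreeSetoid χ.1 a g → Λ a f = Λ g f := fun a ha hag => by
    rw [← hpf, hΛ.map_idemInd_mul_congr (hp a ha g hg hag)]
  calc ∑ a ∈ I with agreeSetoid χ.1 a g, (idemInd (dom a) * φ a) χ • Λ a f
      = ∑ a ∈ I with agreeSetoid χ.1 a g, (idemInd (dom a) * φ a) χ • Λ g f :=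
        Finset.sum_congr rfl fun a ha => by
          rw [hconst a (Finset.mem_filter.1 ha).1 (Finset.mem_filter.1 ha).2]
    _ = 0 := by rw [← Finset.sum_smul, sum_agree_apply_eq_zero hφ χ g, zero_smul]

theorem exists_linearMap (hΛ : IsGermCompatible Λ) :
    ∃ R : CcAlg S →ₗ[ℂ] E, ∀ g φ, R (d g φ) = Λ g φ := by
  let L : (LeftHull S →₀ C(omega S, ℂ)) →ₗ[ℂ] CcAlg S := Finsupp.lsum ℂ fun g =>
    { toFun := d g, map_add' := d_add g, map_smul' := d_smul g }
  let T : (LeftHull S →₀ C(omega S, ℂ)) →ₗ[ℂ] E := Finsupp.lsum ℂ fun g => (Λ g).toLinearMap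
  have hL (g φ) : L (Finsupp.single g φ) = d g φ := Finsupp.lsum_single ..
  have hker : LinearMap.ker L ≤ LinearMap.ker T := fun x hx => hΛ.sum_apply_eq_zero hx
  have hsurj : LinearMap.range L = ⊤ := eq_top_iff.2 fun f _ => by
    induction f using CcAlg.induction with
    | hd g φ => exact ⟨_, hL g φ⟩
    | h0 => exact zero_mem _
    | hadd f f' h h' => exact add_mem (h trivial) (h' trivial)
    | hsmul c f h => exact Submodule.smul_mem _ c (h trivial)
  let e := L.quotKerEquivOfSurjective (LinearMap.range_eq_top.1 hsurj)
  refine ⟨(LinearMap.ker L).liftQ T hker ∘ₗ e.symm, fun g φ => ?_⟩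
  have he : e.symm (d g φ) = Submodule.Quotient.mk (Finsupp.single g φ) :=
    e.symm_apply_eq.2 (hL g φ).symm
  rw [LinearMap.comp_apply, LinearEquiv.coe_coe, he, Submodule.liftQ_apply]
  exact Finsupp.lsum_single ..

end IsGermCompatible

end GermCompatible

section UniversalProperty

open LeftHull Idem CcAlg
open GP (pull)
open semiChars (omega)
open scoped CStarAlgebra

variable {S : Type u} [LeftCancelMonoid S] {B : Type w} [CStarAlgebra B]

/-- The joint spectrum of the projections `e p` maps to `Ω(S)`, since the cover relations hold at
each of its points. -/
theorem RespectsCovers.exists_unitsRep {e : Idem S →* B} (he : RespectsCovers e)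
    (hsa : ∀ p, IsSelfAdjoint (e p)) : ∃ π : C(omega S, ℂ) →⋆ₐ[ℂ] B, ∀ p, π (idemInd p) = e p := by
  obtain ⟨K, _, _, J, f, hJ, hf⟩ := exists_injective_continuousMap_hom e hsa
  have hfe : (fun p => (J : C(K, ℂ) →+* B) (f p)) = e := funext hf
  obtain ⟨Y, hY⟩ := exists_continuousMap_omega
    (RespectsCovers.of_map (J := (J : C(K, ℂ) →+* B)) hJ (hfe ▸ he) : RespectsCovers f)
  refine ⟨J.comp (ContinuousMap.compStarAlgHom' ℂ ℂ Y), fun p => ?_⟩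
  rw [← hf p]
  exact congrArg J (ContinuousMap.ext (hY p))

namespace IsHullRep

variable {V : LeftHull S →* B}

theorem isSelfAdjoint_map_val (hV : IsHullRep V) (p : Idem S) : IsSelfAdjoint (V p.1) := by
  rw [IsSelfAdjoint, ← hV.map_inv, p.inv_val]

theorem exists_unitsRep (hV : IsHullRep V) :
    ∃ π : C(omega S, ℂ) →⋆ₐ[ℂ] B, ∀ p : Idem S, π (idemInd p) = V p.1 :=
  RespectsCovers.exists_unitsRep (e := V.comp (valHom S)) hV.respectsCovers hV.isSelfAdjoint_map_val

variable {π : C(omega S, ℂ) →⋆ₐ[ℂ] B}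

theorem unitsRep_mul_map (hπ : ∀ p : Idem S, π (idemInd p) = V p.1) (h : LeftHull S)
    (φ : C(omega S, ℂ)) : π φ * V h = V h * π (pull h φ) := by
  let πL : C(omega S, ℂ) →L[ℂ] B := ⟨π.toAlgHom.toLinearMap, map_continuous π⟩
  have heq : ((ContinuousLinearMap.mul ℂ B).flip (V h)).comp πL =
      (ContinuousLinearMap.mul ℂ B (V h)).comp (πL.comp (pullCLM h)) := by
    refine ContinuousLinearMap.ext_on dense_span_idemInd ?_
    rintro _ ⟨p, rfl⟩
    change π (idemInd p) * V h = V h * π (pull h (idemInd p))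
    rw [pull_idemInd, hπ, hπ, ← map_mul, ← map_mul, val_mul_eq_mul_conj]
  exact DFunLike.congr_fun heq φ

theorem exists_linearMap (hπ : ∀ p : Idem S, π (idemInd p) = V p.1) :
    ∃ R : CcAlg S →ₗ[ℂ] B, ∀ g φ, R (d g φ) = V g * π φ := by
  let πL : C(omega S, ℂ) →L[ℂ] B := ⟨π.toAlgHom.toLinearMap, map_continuous π⟩
  have hΛ : IsGermCompatible fun g => (ContinuousLinearMap.mul ℂ B (V g)).comp πL :=
    { map_idemInd_dom_mul := fun g φ => by
        change V g * π (idemInd (dom g) * φ) = V g * π φ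
        rw [map_mul, hπ, ← mul_assoc, ← map_mul, mul_dom]
      map_idemInd_mul_congr := fun {a b p} hab φ => by
        change V a * π (idemInd p * φ) = V b * π (idemInd p * φ)
        rw [map_mul, hπ, ← mul_assoc, ← mul_assoc, ← map_mul, ← map_mul, hab] }
  exact hΛ.exists_linearMap

theorem exists_rep (hV : IsHullRep V) : ∃ ρ : CcAlg S →⋆ₐ[ℂ] B, ∀ g, ρ (d g 1) = V g := by
  obtain ⟨π, hπ⟩ := hV.exists_unitsRep
  obtain ⟨R, hR⟩ := exists_linearMap hπ
  have hmul_d (g h φ ψ) : R (d g φ * d h ψ) = R (d g φ) * R (d h ψ) :=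
    calc R (d g φ * d h ψ) = V g * (V h * π (pull h φ)) * π ψ := by
          rw [d_mul, hR, map_mul, map_mul]; simp only [mul_assoc]
      _ = R (d g φ) * R (d h ψ) := by
          rw [← unitsRep_mul_map hπ, hR, hR]; simp only [mul_assoc]
  have hstar_d (g φ) : R (star (d g φ)) = star (R (d g φ)) := by
    rw [d_star, hR, hR, ← unitsRep_mul_map hπ, star_mul, hV.map_inv, map_star]
  have hmul (f f') : R (f * f') = R f * R f' := by
    induction f using CcAlg.induction with
    | hd g φ =>
      induction f' using CcAlg.induction with
      | hd h ψ => exact hmul_d g h φ ψ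
      | h0 => rw [mul_zero, map_zero, mul_zero]
      | hadd f f' h h' => rw [mul_add, map_add, map_add, mul_add, h, h']
      | hsmul c f h => rw [mul_smul_comm, map_smul, map_smul, mul_smul_comm, h]
    | h0 => rw [zero_mul, map_zero, zero_mul]
    | hadd f f'' h h' => rw [add_mul, map_add, map_add, add_mul, h, h']
    | hsmul c f h => rw [smul_mul_assoc, map_smul, map_smul, smul_mul_assoc, h]
  have hstar (f) : R (star f) = star (R f) := by
    induction f using CcAlg.induction with
    | hd g φ => exact hstar_d g φ
    | h0 => rw [star_zero, map_zero, star_zero]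
    | hadd f f' h h' => rw [star_add, map_add, map_add, star_add, h, h']
    | hsmul c f h => rw [star_smul, map_smul, map_smul, star_smul, h]
  have hd_one (g) : R (d g 1) = V g := by rw [hR, map_one, mul_one]
  exact ⟨{ AlgHom.ofLinearMap R ((hd_one 1).trans (map_one V)) hmul with map_star' := hstar },
    hd_one⟩

end IsHullRep

end UniversalProperty

theorem mainTheorem12_general (S : Type u) [LeftCancelMonoid S] :
    HullRelations (gpGenerator : S → FullGPAlgebra S) ∧
    (StarAlgebra.adjoin ℂ (Set.range (gpGenerator : S → FullGPAlgebra S))).topologicalClosure = ⊤ ∧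
    ∀ (B : Type w) [CStarAlgebra B] (b : S → B), HullRelations b →
      ∃! φ : FullGPAlgebra S →⋆ₐ[ℂ] B, ∀ s : S, φ (gpGenerator s) = b s := by
  refine ⟨hullRelations_gpGenerator, adjoin_gpGenerator_dense, fun B _ b hb => ?_⟩
  obtain ⟨ρ, hρ⟩ := hb.isHullRep.exists_rep
  have hgen (s : S) : CStarEnvelope.lift ρ (gpGenerator s) = b s := by
    rw [gpGenerator_eq, CStarEnvelope.lift_of, hρ, hb.algElemHom_tr]
  refine ⟨CStarEnvelope.lift ρ, hgen, fun ψ hψ => ?_⟩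
  refine starAlgHom_eq_of_eqOn_of_dense adjoin_gpGenerator_dense ?_
  rintro _ ⟨s, rfl⟩
  exact (hψ s).trans (hgen s).symm

theorem mainTheorem12 (S : Type u) [LeftCancelMonoid S] [Countable S] :
    HullRelations (gpGenerator : S → FullGPAlgebra S) ∧
    (StarAlgebra.adjoin ℂ (Set.range (gpGenerator : S → FullGPAlgebra S))).topologicalClosure = ⊤ ∧
    ∀ (B : Type w) [CStarAlgebra B] (b : S → B), HullRelations b →
      ∃! φ : FullGPAlgebra S →⋆ₐ[ℂ] B, ∀ s : S, φ (gpGenerator s) = b s :=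
  mainTheorem12_general S
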